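/- Let $M$ be a smooth manifold (Hausdorff, second countable, finite-dimensional, without boundary) and let $\mathcal F$ be a smooth foliation of $M$, of any dimension and codimension. Let $M/\mathcal F$ be the set of leaves, $p\colon M\to M/\mathcal F$ the projection, and give $M/\mathcal F$ the quotient diffeology, i.e. the smooth diffeology generated by the maps $p\circ\alpha$ with $\alpha$ a smooth map from a Euclidean space (equivalently, from an open subset of one) to $M$. Let $\Omega^*(M/\mathcal F)$ be its De Rham complex: a $k$-form $\omega$ is a family of smooth $k$-forms $\omega_\gamma$ on the domains of the plots $\gamma$ of $M/\mathcal F$ with $\omega_{\gamma\circ h}=h^*\omega_\gamma$ for all smooth maps $h$ into the domain of $\gamma$, and $d\omega=\{d\omega_\gamma\}$. Let $\Omega^*_b(M,\mathcal F)\subset\Omega^*(M)$ be the complex of base-like forms, i.e. of the smooth forms $\eta$ on $M$ with $i_X\eta=0$ and $i_X d\eta=0$ for every smooth vector field $X$ tangent to $\mathcal F$. Then there is an isomorphism of differential complexes $$p^*\colon \Omega^*(M/\mathcal F)\longrightarrow\Omega^*_b(M,\mathcal F)$$ induced by the projection $p$, i.e. such that $\alpha^*(p^*\omega)=\omega_{p\circ\alpha}$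 for every $\omega\in\Omega^*(M/\mathcal F)$ and every plot (smooth map) $\alpha$ of $M$. Consequently $p^*$ induces isomorphisms $H^k(M/\mathcal F)\cong H^k_b(M,\mathcal F)$ for all $k\ge 0$. -/

import Mathlib

open scoped Manifold ContDiff Topology
open CategoryTheory

universe u

namespace FoliationDeRham

noncomputable section

/-- The Euclidean space `ℝⁿ`. -/
abbrev Eucl (n : ℕ) : Type := EuclideanSpace ℝ (Fin n)

/-! ### The De Rham complex of a diffeological space -/

section Diffeological

variable {X : Type u} [DiffeologicalSpace X]

/-- `Plot X m` is the set of plots `ℝᵐ → X` of the diffeological space `X`. -/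
def Plot (X : Type u) [DiffeologicalSpace X] (m : ℕ) : Type u :=
  {α : Eucl m → X // Diffeology.IsPlot α}

/-- The plot `α ∘ h`. -/
def Plot.reparam {l m : ℕ} (α : Plot X m) (h : Eucl l → Eucl m) (hh : ContDiff ℝ ∞ h) :
    Plot X l :=
  ⟨α.1 ∘ h, Diffeology.isPlot_reparam α.2 hh⟩

/-- The space `Ω^k(X)` of De Rham `k`-forms on a diffeological space: the families of smooth
`k`-forms `θ_α` on the domains of the plots `α` of `X` such that `θ_{α ∘ h} = h^* θ_α` for every
smooth map `h`. (As in Mathlib's `DiffeologicalSpace`, plots are defined on whole spaces `ℝᵐ`.) -/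
def DForm (k : ℕ) (X : Type u) [DiffeologicalSpace X] :
    Submodule ℝ (∀ m : ℕ, Plot X m → Eucl m → (Eucl m) [⋀^Fin k]→L[ℝ] ℝ) where
  carrier := {θ | (∀ m (α : Plot X m), ContDiff ℝ ∞ (θ m α)) ∧
    ∀ l m (α : Plot X m) (h : Eucl l → Eucl m) (hh : ContDiff ℝ ∞ h) (x : Eucl l),
      θ l (α.reparam h hh) x = (θ m α (h x)).compContinuousLinearMap (fderiv ℝ h x)}
  add_mem' := by
    rintro θ η ⟨h1, h2⟩ ⟨h3, h4⟩
    refine ⟨fun m α => (h1 m α).add (h3 m α), fun l m α h hh x => ?_⟩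
    simp only [Pi.add_apply, h2 l m α h hh x, h4 l m α h hh x]
    rfl
  zero_mem' := by
    refine ⟨fun m α => contDiff_const, fun l m α h hh x => ?_⟩
    rfl
  smul_mem' := by
    rintro c θ ⟨h1, h2⟩
    refine ⟨fun m α => (h1 m α).const_smul c, fun l m α h hh x => ?_⟩
    simp only [Pi.smul_apply, h2 l m α h hh x]
    rfl

theorem two_le_infty : minSmoothness ℝ 2 ≤ (∞ : WithTop ℕ∞) := by
  simpa using (WithTop.coe_le_coe.2 le_top : ((2 : ℕ∞) : WithTop ℕ∞) ≤ ∞)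

theorem contDiff_extDeriv {m k : ℕ} {θ : Eucl m → (Eucl m) [⋀^Fin k]→L[ℝ] ℝ}
    (h : ContDiff ℝ ∞ θ) : ContDiff ℝ ∞ (extDeriv θ) := by
  have h1 : ContDiff ℝ ∞ (fderiv ℝ θ) := h.fderiv_right (by simp)
  have h2 := ContinuousLinearMap.contDiff (𝕜 := ℝ) (n := ∞) (E := Eucl m →L[ℝ] (Eucl m) [⋀^Fin k]→L[ℝ] ℝ)
    (F := (Eucl m) [⋀^Fin (k + 1)]→L[ℝ] ℝ)
    (ContinuousAlternatingMap.alternatizeUncurryFinCLM ℝ (Eucl m) ℝ)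
  exact h2.comp h1

theorem DForm.d_mem {k : ℕ} (θ : DForm k X) :
    (fun m α => extDeriv (θ.1 m α)) ∈ DForm (k + 1) X := by
  refine ⟨fun m α => contDiff_extDeriv (θ.2.1 m α), fun l m α h hh x => ?_⟩
  have : θ.1 l (α.reparam h hh) =
      fun x => (θ.1 m α (h x)).compContinuousLinearMap (fderiv ℝ h x) :=
    funext fun x => θ.2.2 l m α h hh x
  simp only [this]
  exact extDeriv_pullback (r := ∞) ((θ.2.1 m α).differentiable (by simp) _) hh.contDiffAt
    two_le_infty

/-- The exterior differential `d θ = {d θ_α}`. -/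
def DForm.d (k : ℕ) (X : Type u) [DiffeologicalSpace X] : DForm k X →ₗ[ℝ] DForm (k + 1) X where
  toFun θ := ⟨fun m α => extDeriv (θ.1 m α), DForm.d_mem θ⟩
  map_add' θ η := by
    ext m α x : 4
    exact extDeriv_add ((θ.2.1 m α).differentiable (by simp) _)
      ((η.2.1 m α).differentiable (by simp) _)
  map_smul' c θ := by
    ext m α x : 4
    exact extDeriv_smul c _

theorem DForm.d_d {k : ℕ} (θ : DForm k X) : DForm.d (k + 1) X (DForm.d k X θ) = 0 := by
  ext m α x : 4
  exact congrFun (extDeriv_extDeriv (θ.2.1 m α) two_le_infty) x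

/-- The De Rham complex `Ω^*(X)` of a diffeological space. -/
def deRhamComplex (X : Type u) [DiffeologicalSpace X] : CochainComplex (ModuleCat.{u} ℝ) ℕ :=
  CochainComplex.of (fun k => ModuleCat.of ℝ (DForm k X)) (fun k => ModuleCat.ofHom (DForm.d k X))
    (fun k => by ext θ : 2; exact DForm.d_d θ)

end Diffeological

/-! ### Differential forms on a manifold -/

section Manifold

variable {n : ℕ} {M : Type u} [TopologicalSpace M] [ChartedSpace (Eucl n) M]

/-- The manifold diffeology of `M`: its plots are the smooth maps `ℝᵐ → M`. -/
abbrev manifoldDiffeology (n : ℕ) (M : Type u) [TopologicalSpace M] [ChartedSpace (Eucl n) M] :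
    DiffeologicalSpace M :=
  .ofCorePlotsOn
    { isPlotOn := fun {m s} _ p => ContMDiffOn (𝓡 m) (𝓡 n) ∞ p s
      isPlotOn_congr := fun _ _ _ h => contMDiffOn_congr h
      isPlot := fun {m} p => ContMDiff (𝓡 m) (𝓡 n) ∞ p
      isPlotOn_univ := contMDiffOn_univ
      isPlot_const := fun _ => contMDiff_const
      isPlotOn_reparam := fun _ _ _ h hp hf => hp.comp hf.contMDiffOn h.subset_preimage
      locality := fun _ _ h x hx => by
        obtain ⟨v, hv, hxv, hp⟩ := h x hx
        exact ((hp x hxv).contMDiffAt (hv.mem_nhds hxv)).contMDiffWithinAt }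

/-- The fields, not necessarily continuous, of alternating `k`-linear forms on the tangent spaces
of `M`. -/
abbrev AltField (k n : ℕ) (M : Type u) [TopologicalSpace M] [ChartedSpace (Eucl n) M] : Type u :=
  ∀ x : M, (TangentSpace (𝓡 n) x) [⋀^Fin k]→L[ℝ] ℝ

instance AltField.instAddCommGroup (k n : ℕ) (M : Type u) [TopologicalSpace M]
    [ChartedSpace (Eucl n) M] : AddCommGroup (AltField k n M) := Pi.addCommGroup

/-- The coordinate expression `e⁻¹^* θ` of `θ` on the target of the chart `e`. -/
def coordRep {k : ℕ} (θ : AltField k n M)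
    (e : OpenPartialHomeomorph M (Eucl n)) (y : Eucl n) : (Eucl n) [⋀^Fin k]→L[ℝ] ℝ :=
  (θ (e.symm y)).compContinuousLinearMap
    (mfderiv (𝓡 n) (𝓡 n) e.symm y : Eucl n →L[ℝ] TangentSpace (𝓡 n) (e.symm y))

/-- The pull-back `α^* θ` along a map `α : ℝᵐ → M`. -/
def pullbackPlot {k m : ℕ} (α : Eucl m → M)
    (θ : AltField k n M) (y : Eucl m) :
    (Eucl m) [⋀^Fin k]→L[ℝ] ℝ :=
  (θ (α y)).compContinuousLinearMap
    (mfderiv (𝓡 m) (𝓡 n) α y : Eucl m →L[ℝ] TangentSpace (𝓡 n) (α y))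

/-- The space of (usual) smooth differential `k`-forms on the manifold `M`. -/
def MForm (k n : ℕ) (M : Type u) [TopologicalSpace M] [ChartedSpace (Eucl n) M] :
    Submodule ℝ (AltField k n M) where
  carrier := {θ | ∀ e ∈ atlas (Eucl n) M, ContDiffOn ℝ ∞ (coordRep θ e) e.target}
  add_mem' := fun h1 h2 e he => (h1 e he).add (h2 e he)
  zero_mem' := fun _ _ => contDiffOn_const (c := 0)
  smul_mem' := fun c _ h e he => (h e he).const_smul c

theorem MForm.contDiffAt {k : ℕ} (θ : MForm k n M) {e : OpenPartialHomeomorph M (Eucl n)}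
    (he : e ∈ atlas (Eucl n) M) {y : Eucl n} (hy : y ∈ e.target) :
    ContDiffAt ℝ ∞ (coordRep θ.1 e) y :=
  (θ.2 e he).contDiffAt (e.open_target.mem_nhds hy)

/-- The exterior differential of a field of alternating forms: at `x` it is the pull-back
`e^* d(e⁻¹^* θ)` for the preferred chart `e` at `x`. -/
def extDerivM {k : ℕ} (θ : AltField k n M) (x : M) :
    (TangentSpace (𝓡 n) x) [⋀^Fin (k + 1)]→L[ℝ] ℝ :=
  (extDeriv (coordRep θ (chartAt (Eucl n) x)) (chartAt (Eucl n) x x)).compContinuousLinearMap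
    (mfderiv (𝓡 n) (𝓡 n) (chartAt (Eucl n) x) x : TangentSpace (𝓡 n) x →L[ℝ] Eucl n)

variable [IsManifold (𝓡 n) ∞ M]

theorem mdifferentiableAt_chart {e : OpenPartialHomeomorph M (Eucl n)}
    (he : e ∈ atlas (Eucl n) M) {x : M} (hx : x ∈ e.source) :
    MDifferentiableAt (𝓡 n) (𝓡 n) e x :=
  haveI : IsManifold (𝓡 n) 1 M := .of_le (n := ∞) (by simp)
  mdifferentiableAt_atlas he hx

theorem mdifferentiableAt_chart_symm {e : OpenPartialHomeomorph M (Eucl n)}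
    (he : e ∈ atlas (Eucl n) M) {y : Eucl n} (hy : y ∈ e.target) :
    MDifferentiableAt (𝓡 n) (𝓡 n) e.symm y :=
  haveI : IsManifold (𝓡 n) 1 M := .of_le (n := ∞) (by simp)
  mdifferentiableAt_atlas_symm he hy

/-- Derivative of a change of charts. -/
theorem fderiv_transition {e c : OpenPartialHomeomorph M (Eucl n)}
    (he : e ∈ atlas (Eucl n) M) (hc : c ∈ atlas (Eucl n) M) {y : Eucl n}
    (hy : y ∈ e.target) (hyc : e.symm y ∈ c.source) :
    (fderiv ℝ (c ∘ e.symm) y : Eucl n →L[ℝ] Eucl n) =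
      (mfderiv (𝓡 n) (𝓡 n) c (e.symm y) : TangentSpace (𝓡 n) (e.symm y) →L[ℝ] Eucl n).comp
        (mfderiv (𝓡 n) (𝓡 n) e.symm y : Eucl n →L[ℝ] TangentSpace (𝓡 n) (e.symm y)) := by
  rw [← mfderiv_eq_fderiv]
  exact mfderiv_comp y (mdifferentiableAt_chart hc hyc) (mdifferentiableAt_chart_symm he hy)

/-- Change of charts for coordinate expressions. -/
theorem coordRep_transition {k : ℕ} (θ : AltField k n M)
    {e c : OpenPartialHomeomorph M (Eucl n)}
    (he : e ∈ atlas (Eucl n) M) (hc : c ∈ atlas (Eucl n) M) {y : Eucl n}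
    (hy : y ∈ e.target) (hyc : e.symm y ∈ c.source) :
    coordRep θ e y = (coordRep θ c (c (e.symm y))).compContinuousLinearMap
      (fderiv ℝ (c ∘ e.symm) y) := by
  have hev : (c.symm ∘ (c ∘ e.symm)) =ᶠ[𝓝 y] e.symm := by
    have : ∀ᶠ z in 𝓝 y, e.symm z ∈ c.source :=
      (e.continuousAt_symm hy).eventually (c.open_source.mem_nhds hyc)
    filter_upwards [this] with z hz
    exact c.left_inv hz
  have h1 : mfderiv (𝓡 n) (𝓡 n) (c.symm ∘ (c ∘ e.symm)) y =
      mfderiv (𝓡 n) (𝓡 n) e.symm y := hev.mfderiv_eq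
  have hce : MDifferentiableAt (𝓡 n) (𝓡 n) (c ∘ e.symm) y :=
    (mdifferentiableAt_chart hc hyc).comp y (mdifferentiableAt_chart_symm he hy)
  have h2 := mfderiv_comp y (mdifferentiableAt_chart_symm hc (c.map_source hyc) :
    MDifferentiableAt (𝓡 n) (𝓡 n) c.symm ((c ∘ e.symm) y)) hce
  ext v
  have key : ∀ (x : M) (_ : x = e.symm y) (L : Eucl n →L[ℝ] Eucl n)
      (_ : L = (mfderiv (𝓡 n) (𝓡 n) e.symm y : Eucl n →L[ℝ] Eucl n)),
      θ (e.symm y) (fun i => (mfderiv (𝓡 n) (𝓡 n) e.symm y : Eucl n →L[ℝ] Eucl n) (v i)) =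
      θ x (fun i => L (v i)) := by
    rintro x rfl L rfl
    rfl
  have := key (c.symm (c (e.symm y))) (c.left_inv hyc)
    ((mfderiv (𝓡 n) (𝓡 n) c.symm ((c ∘ e.symm) y) : Eucl n →L[ℝ] Eucl n).comp
      (fderiv ℝ (c ∘ e.symm) y)) (by
        have h3 : (fderiv ℝ (c ∘ e.symm) y : Eucl n →L[ℝ] Eucl n) =
            (mfderiv (𝓡 n) (𝓡 n) (c ∘ e.symm) y : Eucl n →L[ℝ] Eucl n) :=
          mfderiv_eq_fderiv.symm
        exact (congrArg (fun T : Eucl n →L[ℝ] Eucl n =>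
          (mfderiv (𝓡 n) (𝓡 n) c.symm ((c ∘ e.symm) y) : Eucl n →L[ℝ] Eucl n).comp T) h3).trans
          (h2.symm.trans h1))
  exact this

theorem contDiffAt_transition {e c : OpenPartialHomeomorph M (Eucl n)}
    (he : e ∈ atlas (Eucl n) M) (hc : c ∈ atlas (Eucl n) M) {y : Eucl n}
    (hy : y ∈ e.target) (hyc : e.symm y ∈ c.source) : ContDiffAt ℝ ∞ (c ∘ e.symm) y := by
  have h1 : ContMDiffAt (𝓡 n) (𝓡 n) ∞ c (e.symm y) :=
    contMDiffAt_of_mem_maximalAtlas (IsManifold.subset_maximalAtlas hc) hyc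
  have h2 : ContMDiffAt (𝓡 n) (𝓡 n) ∞ e.symm y :=
    contMDiffAt_symm_of_mem_maximalAtlas (IsManifold.subset_maximalAtlas he) hy
  exact (h1.comp y h2).contDiffAt

/-- In every chart, `d θ` is the exterior differential of the coordinate expression of `θ`. -/
theorem coordRep_extDerivM {k : ℕ} (θ : MForm k n M) {e : OpenPartialHomeomorph M (Eucl n)}
    (he : e ∈ atlas (Eucl n) M) {y : Eucl n} (hy : y ∈ e.target) :
    coordRep (extDerivM θ.1) e y = extDeriv (coordRep θ.1 e) y := by
  set c := chartAt (Eucl n) (e.symm y) with hcdef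
  have hc : c ∈ atlas (Eucl n) M := chart_mem_atlas _ _
  have hyc : e.symm y ∈ c.source := mem_chart_source _ _
  have hev : coordRep θ.1 e =ᶠ[𝓝 y] fun z =>
      (coordRep θ.1 c ((c ∘ e.symm) z)).compContinuousLinearMap (fderiv ℝ (c ∘ e.symm) z) := by
    have : ∀ᶠ z in 𝓝 y, e.symm z ∈ c.source :=
      (e.continuousAt_symm hy).eventually (c.open_source.mem_nhds hyc)
    filter_upwards [this, e.open_target.mem_nhds hy] with z hz hz'
    exact coordRep_transition θ.1 he hc hz' hz
  rw [hev.extDeriv_eq, extDeriv_pullback (r := ∞) (f := c ∘ e.symm)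
    ((MForm.contDiffAt θ hc (c.map_source hyc)).differentiableAt (by simp))
    (contDiffAt_transition he hc hy hyc) two_le_infty, fderiv_transition he hc hy hyc]
  rfl

theorem MForm.d_mem {k : ℕ} (θ : MForm k n M) : extDerivM θ.1 ∈ MForm (k + 1) n M := by
  intro e he y hy
  have h0 : ContDiffAt ℝ ∞ (fderiv ℝ (coordRep θ.1 e)) y :=
    (MForm.contDiffAt θ he hy).fderiv_right (by simp)
  have h2 := ContinuousLinearMap.contDiff (𝕜 := ℝ) (n := ∞) (E := Eucl n →L[ℝ] (Eucl n) [⋀^Fin k]→L[ℝ] ℝ)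
    (F := (Eucl n) [⋀^Fin (k + 1)]→L[ℝ] ℝ)
    (ContinuousAlternatingMap.alternatizeUncurryFinCLM ℝ (Eucl n) ℝ)
  have h1 : ContDiffAt ℝ ∞ (extDeriv (coordRep θ.1 e)) y := h2.contDiffAt.comp y h0
  refine (h1.congr_of_eventuallyEq ?_).contDiffWithinAt
  filter_upwards [e.open_target.mem_nhds hy] with z hz
  exact coordRep_extDerivM θ he hz

/-- The exterior differential `d : Ω^k(M) → Ω^{k+1}(M)`. -/
def MForm.d (k n : ℕ) (M : Type u) [TopologicalSpace M] [ChartedSpace (Eucl n) M]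
    [IsManifold (𝓡 n) ∞ M] : MForm k n M →ₗ[ℝ] MForm (k + 1) n M where
  toFun θ := ⟨extDerivM θ.1, MForm.d_mem θ⟩
  map_add' θ η := by
    ext x : 2
    have hx := mem_chart_target (Eucl n) x
    have h : extDeriv (coordRep θ.1 (chartAt (Eucl n) x) + coordRep η.1 (chartAt (Eucl n) x))
        (chartAt (Eucl n) x x) = _ :=
      extDeriv_add ((MForm.contDiffAt θ (chart_mem_atlas _ x) hx).differentiableAt (by simp))
        ((MForm.contDiffAt η (chart_mem_atlas _ x) hx).differentiableAt (by simp))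
    exact congrArg (fun A => A.compContinuousLinearMap
      (mfderiv (𝓡 n) (𝓡 n) (chartAt (Eucl n) x) x : TangentSpace (𝓡 n) x →L[ℝ] Eucl n)) h
  map_smul' c θ := by
    ext x : 2
    have h : extDeriv (c • coordRep θ.1 (chartAt (Eucl n) x)) (chartAt (Eucl n) x x) = _ :=
      extDeriv_smul c _
    exact congrArg (fun A => A.compContinuousLinearMap
      (mfderiv (𝓡 n) (𝓡 n) (chartAt (Eucl n) x) x : TangentSpace (𝓡 n) x →L[ℝ] Eucl n)) h

theorem MForm.d_d {k : ℕ} (θ : MForm k n M) : MForm.d (k + 1) n M (MForm.d k n M θ) = 0 := by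
  ext x : 2
  have hx := mem_chart_target (Eucl n) x
  have hc := chart_mem_atlas (Eucl n) x
  have hev : coordRep (extDerivM θ.1) (chartAt (Eucl n) x) =ᶠ[𝓝 (chartAt (Eucl n) x x)]
      extDeriv (coordRep θ.1 (chartAt (Eucl n) x)) := by
    filter_upwards [(chartAt (Eucl n) x).open_target.mem_nhds hx] with z hz
    exact coordRep_extDerivM θ hc hz
  have h : extDeriv (coordRep (extDerivM θ.1) (chartAt (Eucl n) x)) (chartAt (Eucl n) x x) = 0 := by
    rw [hev.extDeriv_eq]
    exact extDeriv_extDeriv_apply (MForm.contDiffAt θ hc hx) two_le_infty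
  exact congrArg (fun A => A.compContinuousLinearMap
    (mfderiv (𝓡 n) (𝓡 n) (chartAt (Eucl n) x) x : TangentSpace (𝓡 n) x →L[ℝ] Eucl n)) h

/-- The interior product `i_X θ` vanishes, i.e. `θ` vanishes as soon as one of its arguments is a
value of `X` (for a `0`-form this always holds: then `i_X θ = 0` by convention). -/
def InteriorVanishes {k : ℕ} (X : ∀ x : M, TangentSpace (𝓡 n) x)
    (θ : AltField k n M) : Prop :=
  ∀ (x : M) (v : Fin k → TangentSpace (𝓡 n) x) (i : Fin k), v i = X x → θ x v = 0

end Manifold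

/-! ### Foliations -/

section Foliation

/-- A smooth foliation of dimension `p` and codimension `q` on `M`, given by a foliated atlas:
a cover of `M` by smooth charts onto products `A × B ⊆ ℝᵖ × ℝ^q` (`A` connected), such that locally
the transverse coordinate of a chart depends only on the transverse coordinate of any other. -/
structure Foliation (n p q : ℕ) (M : Type u) [TopologicalSpace M] [ChartedSpace (Eucl n) M] where
  /-- the foliated charts -/
  charts : Set (OpenPartialHomeomorph M (Eucl p × Eucl q))
  contMDiffOn : ∀ e ∈ charts, ContMDiffOn (𝓡 n) 𝓘(ℝ, Eucl p × Eucl q) ∞ e e.source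
  contMDiffOn_symm : ∀ e ∈ charts, ContMDiffOn 𝓘(ℝ, Eucl p × Eucl q) (𝓡 n) ∞ e.symm e.target
  target_eq : ∀ e ∈ charts, ∃ (A : Set (Eucl p)) (B : Set (Eucl q)),
    IsOpen A ∧ IsConnected A ∧ IsOpen B ∧ e.target = A ×ˢ B
  cover : ∀ x : M, ∃ e ∈ charts, x ∈ e.source
  compatible : ∀ e ∈ charts, ∀ e' ∈ charts, ∀ x ∈ e.source ∩ e'.source,
    ∃ g : Eucl q → Eucl q, ∀ᶠ y in 𝓝 x, (e' y).2 = g (e y).2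

variable {n p q : ℕ} {M : Type u} [TopologicalSpace M] [ChartedSpace (Eucl n) M]

/-- Two points lie in a common plaque of a foliated chart. -/
def Foliation.SamePlaque (F : Foliation n p q M) (x y : M) : Prop :=
  ∃ e ∈ F.charts, x ∈ e.source ∧ y ∈ e.source ∧ (e x).2 = (e y).2

/-- The equivalence relation whose classes are the leaves: two points lie in the same leaf if and
only if they are joined by a chain of plaques. -/
def Foliation.leafSetoid (F : Foliation n p q M) : Setoid M :=
  Relation.EqvGen.setoid F.SamePlaque

/-- The space of leaves `M/F`. -/
def Foliation.LeafSpace (F : Foliation n p q M) : Type u := Quotient F.leafSetoid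

/-- The projection `M → M/F`. -/
def Foliation.proj (F : Foliation n p q M) (x : M) : F.LeafSpace := Quotient.mk F.leafSetoid x

/-- The quotient diffeology on `M/F`, generated by the maps `proj ∘ α` with `α` a plot of the
manifold diffeology of `M`. -/
instance Foliation.leafSpaceDiffeology (F : Foliation n p q M) :
    DiffeologicalSpace F.LeafSpace :=
  DiffeologicalSpace.generateFrom
    {P | ∃ α : Eucl P.1 → M, α ∈ (manifoldDiffeology n M).plots P.1 ∧ P.2 = F.proj ∘ α}

/-- The plot `proj ∘ α` of `M/F` determined by a plot `α` of `M`. -/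
def Foliation.projPlot (F : Foliation n p q M) {m : ℕ}
    (α : @Plot M (manifoldDiffeology n M) m) : Plot F.LeafSpace m :=
  ⟨F.proj ∘ α.1, DiffeologicalSpace.isPlot_generatedFrom_of_mem ⟨α.1, α.2, rfl⟩⟩

/-- The vector field `X` is tangent to the foliation. -/
def Foliation.IsTangent (F : Foliation n p q M) (X : ∀ x : M, TangentSpace (𝓡 n) x) : Prop :=
  ∀ e ∈ F.charts, ∀ x ∈ e.source,
    ((mfderiv (𝓡 n) 𝓘(ℝ, Eucl p × Eucl q) e x :
      TangentSpace (𝓡 n) x →L[ℝ] Eucl p × Eucl q) (X x)).2 = 0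

variable [IsManifold (𝓡 n) ∞ M]

/-- The space `Ω_b^k(M, F)` of base-like `k`-forms: the smooth `k`-forms `θ` on `M` such that
`i_X θ = 0` and `i_X dθ = 0` for every smooth vector field `X` tangent to `F`. -/
def Foliation.BaseLike (F : Foliation n p q M) (k : ℕ) : Submodule ℝ (MForm k n M) where
  carrier := {θ | ∀ X : (∀ x : M, TangentSpace (𝓡 n) x),
    ContMDiff (𝓡 n) (𝓡 n).tangent ∞ (fun x => (⟨x, X x⟩ : TangentBundle (𝓡 n) M)) →
    F.IsTangent X → InteriorVanishes X θ.1 ∧ InteriorVanishes X (MForm.d k n M θ).1}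
  add_mem' := by
    intro θ η h1 h2 X hX hF
    obtain ⟨a1, b1⟩ := h1 X hX hF
    obtain ⟨a2, b2⟩ := h2 X hX hF
    refine ⟨fun x v i hv => ?_, fun x v i hv => ?_⟩
    · change θ.1 x v + η.1 x v = 0
      rw [a1 x v i hv, a2 x v i hv, add_zero]
    · rw [map_add]
      change (MForm.d k n M θ).1 x v + (MForm.d k n M η).1 x v = 0
      rw [b1 x v i hv, b2 x v i hv, add_zero]
  zero_mem' := by
    intro X hX hF
    refine ⟨fun x v i hv => rfl, fun x v i hv => ?_⟩
    rw [map_zero]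
    rfl
  smul_mem' := by
    intro c θ h X hX hF
    obtain ⟨a, b⟩ := h X hX hF
    refine ⟨fun x v i hv => ?_, fun x v i hv => ?_⟩
    · change c • θ.1 x v = 0
      rw [a x v i hv, smul_zero]
    · rw [map_smul]
      change c • (MForm.d k n M θ).1 x v = 0
      rw [b x v i hv, smul_zero]

theorem Foliation.BaseLike.d_mem (F : Foliation n p q M) {k : ℕ} (θ : MForm k n M)
    (h : θ ∈ F.BaseLike k) : MForm.d k n M θ ∈ F.BaseLike (k + 1) := by
  intro X hX hF
  refine ⟨(h X hX hF).2, fun x v i hv => ?_⟩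
  rw [MForm.d_d]
  rfl

/-- The exterior differential on base-like forms. -/
def Foliation.BaseLike.d (F : Foliation n p q M) (k : ℕ) :
    F.BaseLike k →ₗ[ℝ] F.BaseLike (k + 1) :=
  (MForm.d k n M).restrict fun θ h => Foliation.BaseLike.d_mem F θ h

/-- The complex `Ω_b^*(M, F)` of base-like forms. -/
def Foliation.baseLikeComplex (F : Foliation n p q M) : CochainComplex (ModuleCat.{u} ℝ) ℕ :=
  CochainComplex.of (fun k => ModuleCat.of ℝ (F.BaseLike k))
    (fun k => ModuleCat.ofHom (Foliation.BaseLike.d F k))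
    (fun k => by ext θ : 3; exact MForm.d_d θ.1)

/-- The morphism of complexes `φ : Ω^*(M/F) → Ω_b^*(M, F)` is the pull-back `p^*` along the
projection `p : M → M/F`: under the tautological map `η ↦ {α^* η}_α` from usual to diffeological
forms on `M`, the form `φ θ` goes to the family `p^* θ = {θ_{p ∘ α}}_α`, that is
`α^* (φ θ) = θ_{p ∘ α}` for every plot `α` of `M`. (This determines `φ`.) -/
def Foliation.IsProjPullback (F : Foliation n p q M)
    (φ : deRhamComplex F.LeafSpace ⟶ F.baseLikeComplex) : Prop :=
  ∀ (k : ℕ) (θ : DForm k F.LeafSpace) (m : ℕ) (α : @Plot M (manifoldDiffeology n M) m),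
    let η : F.BaseLike k := (φ.f k).hom θ
    pullbackPlot α.1 η.1.1 = θ.1 m (F.projPlot α)

end Foliation

end

end FoliationDeRham

/-!
# The De Rham complex of a leaf space and base-like forms

A form `θ` on `M/F` is a compatible family of forms on plots, so its values along the plots
`p ∘ e⁻¹`, for `e` a chart of `M`, glue to a smooth form `p^* θ` on `M` with
`α^* (p^* θ) = θ_{p ∘ α}` (`Foliation.pullbackForm_projPullbackField`). In a foliated chart
`p ∘ e⁻¹` factors through the transverse coordinate, so `p^* θ` and `d (p^* θ) = p^* (d θ)` vanish
on vectors tangent to the leaves. Since plots of `M/F` locally lift to `M`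
(`Foliation.exists_lift`), `p^*` is injective.

For surjectivity, a base-like form `η` is to be pulled back along local lifts, and the point is that
`α^* η = β^* η` for any two plots `α`, `β` of `M` with `p ∘ α = p ∘ β`
(`Foliation.BaseLike.pullbackForm_eq_of_proj_eq`). In a foliated chart the coefficients of `η` are
constant along plaques, so this holds if `α` and `β` have the same transverse coordinate
(`Foliation.BaseLike.pullbackForm_eq`). In general `α z` and `β z` are joined by a chain of plaques
depending on `z`. Countably many kinds of chains suffice (`reaches_of_proj_eq`): from a countable
foliated atlas, and with intermediate points whose tangential coordinates lie in a countable dense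
set. The move along a chain of given kind is a smooth partial map `slide c l` of `M`, which leaves
`η` invariant. So the domain of the plots is a countable union of locally closed sets, and
`α^* η = β^* η` on the interior of each; by Baire's theorem these interiors have dense union, and
`α^* η = β^* η` everywhere by continuity.
-/

namespace FoliationDeRham

noncomputable section

/-! ### Pull-backs of forms along maps from a vector space -/

section Pullback

variable {E E' : Type*} [NormedAddCommGroup E] [NormedSpace ℝ E]
  [NormedAddCommGroup E'] [NormedSpace ℝ E']

/-- Smoothness of the pull-back of a smooth family of alternating maps along a smooth family of
linear maps. -/
theorem contDiffAt_compContinuousLinearMap {F : Type*} [NormedAddCommGroup F] [NormedSpace ℝ F]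
    [FiniteDimensional ℝ E] {k : ℕ}
    {ζ : E' → F [⋀^Fin k]→L[ℝ] ℝ} {L : E' → E →L[ℝ] F} {y : E'}
    (hζ : ContDiffAt ℝ ∞ ζ y) (hL : ContDiffAt ℝ ∞ L y) :
    ContDiffAt ℝ ∞ (fun z => (ζ z).compContinuousLinearMap (L z)) y := by
  let b := Module.finBasis ℝ E
  -- Evaluation on basis vectors embeds the alternating maps into a finite power of `ℝ`.
  let T : (E [⋀^Fin k]→L[ℝ] ℝ) →ₗ[ℝ] ((Fin k → Fin (Module.finrank ℝ E)) → ℝ) :=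
    { toFun := fun f s => f (fun i => b (s i))
      map_add' := fun f g => rfl
      map_smul' := fun c f => rfl }
  have hT : LinearMap.ker T = ⊥ := by
    rw [LinearMap.ker_eq_bot]
    intro f g hfg
    have : f.toContinuousMultilinearMap.toMultilinearMap =
        g.toContinuousMultilinearMap.toMultilinearMap :=
      Module.Basis.ext_multilinear (fun _ => b) fun s => congrFun hfg s
    ext v
    exact congrArg (fun m : MultilinearMap ℝ (fun _ : Fin k => E) ℝ => m v) this
  obtain ⟨S, hS⟩ := T.exists_leftInverse_of_injective hT
  have h1 : ContDiffAt ℝ ∞ (fun z => ContinuousMultilinearMap.compContinuousLinearMap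
      (ζ z).toContinuousMultilinearMap (fun _ => L z)) y := by
    have h2 : ContDiffAt ℝ ∞ (fun z => (ζ z).toContinuousMultilinearMap) y :=
      (ContinuousLinearMap.contDiff (ContinuousAlternatingMap.toContinuousMultilinearMapCLM ℝ :
        (F [⋀^Fin k]→L[ℝ] ℝ) →L[ℝ] _)).contDiffAt.comp y hζ
    have h3 : ContDiffAt ℝ ∞ (fun z =>
        ContinuousMultilinearMap.compContinuousLinearMapContinuousMultilinear ℝ
          (fun _ : Fin k => E) (fun _ : Fin k => F) ℝ (fun _ => L z)) y :=
      (ContinuousMultilinearMap.contDiff _).contDiffAt.comp y (contDiffAt_pi.2 fun _ => hL)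
    exact h3.clm_apply h2
  have h4 : ContDiffAt ℝ ∞ (fun z => T ((ζ z).compContinuousLinearMap (L z))) y := by
    refine contDiffAt_pi.2 fun s => ?_
    exact (ContinuousMultilinearMap.apply ℝ (fun _ : Fin k => E) ℝ
      (fun i => b (s i))).contDiff.contDiffAt.comp y h1
  have h5 := (LinearMap.toContinuousLinearMap S).contDiff.contDiffAt (n := ∞).comp y h4
  refine h5.congr_of_eventuallyEq (Filter.Eventually.of_forall fun z => ?_)
  exact (LinearMap.congr_fun hS _).symm

variable {n : ℕ} {M : Type u} [TopologicalSpace M] [ChartedSpace (Eucl n) M]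

/-- The pull-back `α^* θ` along a map `α : E → M` defined on an arbitrary normed space `E`. For
`E = ℝᵐ` it is `pullbackPlot α θ`, and for `α` the inverse of a chart it is `coordRep`. -/
def pullbackForm {k : ℕ} (α : E → M) (θ : AltField k n M) (y : E) : E [⋀^Fin k]→L[ℝ] ℝ :=
  (θ (α y)).compContinuousLinearMap
    (mfderiv 𝓘(ℝ, E) (𝓡 n) α y : E →L[ℝ] TangentSpace (𝓡 n) (α y))

/-- Substitution of equals, for base points and derivatives whose types depend on the base point. -/
theorem pullbackForm_eq_of_eq {k : ℕ} (θ : AltField k n M) {x x' : M} (hx : x = x')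
    {L L' : E →L[ℝ] Eucl n} (hL : L = L') :
    (θ x).compContinuousLinearMap (L : E →L[ℝ] TangentSpace (𝓡 n) x) =
      (θ x').compContinuousLinearMap (L' : E →L[ℝ] TangentSpace (𝓡 n) x') := by
  subst hx hL
  rfl

theorem pullbackForm_congr {k : ℕ} (θ : AltField k n M) {α β : E → M} {y : E}
    (h : α =ᶠ[𝓝 y] β) : pullbackForm α θ y = pullbackForm β θ y :=
  pullbackForm_eq_of_eq θ h.self_of_nhds h.mfderiv_eq

theorem pullbackForm_comp {k : ℕ} (θ : AltField k n M) {α : E → M} {h : E' → E} {y : E'}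
    (hα : MDifferentiableAt 𝓘(ℝ, E) (𝓡 n) α (h y)) (hh : DifferentiableAt ℝ h y) :
    pullbackForm (α ∘ h) θ y =
      (pullbackForm α θ (h y)).compContinuousLinearMap (fderiv ℝ h y) := by
  have h1 := mfderiv_comp y hα hh.mdifferentiableAt
  have h2 : (mfderiv 𝓘(ℝ, E') 𝓘(ℝ, E) h y : E' →L[ℝ] E) = fderiv ℝ h y := mfderiv_eq_fderiv
  exact pullbackForm_eq_of_eq (E := E') θ rfl (h1.trans (congrArg (fun T : E' →L[ℝ] E =>
    (mfderiv 𝓘(ℝ, E) (𝓡 n) α (h y) : E →L[ℝ] Eucl n).comp T) h2))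

/-- The pull-back along `α`, computed in a chart `e` with values in any normed space. -/
theorem pullbackForm_eq_pullbackForm_symm {k : ℕ} (θ : AltField k n M)
    {e : OpenPartialHomeomorph M E'} {α : E → M} {y : E} (hy : α y ∈ e.source)
    (he : MDifferentiableAt (𝓡 n) 𝓘(ℝ, E') e (α y))
    (he' : MDifferentiableAt 𝓘(ℝ, E') (𝓡 n) e.symm (e (α y)))
    (hα : MDifferentiableAt 𝓘(ℝ, E) (𝓡 n) α y) :
    pullbackForm α θ y =
      (pullbackForm e.symm θ (e (α y))).compContinuousLinearMap (fderiv ℝ (e ∘ α) y) := by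
  have h1 : α =ᶠ[𝓝 y] e.symm ∘ (e ∘ α) := by
    filter_upwards [hα.continuousAt.preimage_mem_nhds (e.open_source.mem_nhds hy)] with z hz
    exact (e.left_inv hz).symm
  rw [pullbackForm_congr θ h1]
  exact pullbackForm_comp θ he' (he.comp y hα).differentiableAt

variable [IsManifold (𝓡 n) ∞ M]

theorem pullbackForm_eq_coordRep {k : ℕ} (θ : AltField k n M) {e : OpenPartialHomeomorph M (Eucl n)}
    (he : e ∈ atlas (Eucl n) M) {α : E → M} {y : E}
    (hα : MDifferentiableAt 𝓘(ℝ, E) (𝓡 n) α y) (hy : α y ∈ e.source) :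
    pullbackForm α θ y =
      (coordRep θ e (e (α y))).compContinuousLinearMap (fderiv ℝ (e ∘ α) y) :=
  pullbackForm_eq_pullbackForm_symm θ hy (mdifferentiableAt_chart he hy)
    (mdifferentiableAt_chart_symm he (e.map_source hy)) hα

theorem eventually_pullbackForm_eq_coordRep {k : ℕ} (θ : AltField k n M)
    {e : OpenPartialHomeomorph M (Eucl n)}
    (he : e ∈ atlas (Eucl n) M) {α : E → M} {y : E}
    (hα : ContMDiffAt 𝓘(ℝ, E) (𝓡 n) ∞ α y) (hy : α y ∈ e.source) :
    pullbackForm α θ =ᶠ[𝓝 y] fun z =>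
      (coordRep θ e ((e ∘ α) z)).compContinuousLinearMap (fderiv ℝ (e ∘ α) z) := by
  have : IsManifold (𝓡 n) 1 M := .of_le (n := ∞) (by simp)
  have h1 : ∀ᶠ z in 𝓝 y, ContMDiffAt 𝓘(ℝ, E) (𝓡 n) 1 α z :=
    (contMDiffAt_iff_contMDiffAt_nhds (by simp)).1 (hα.of_le (by simp))
  filter_upwards [h1, hα.continuousAt.preimage_mem_nhds (e.open_source.mem_nhds hy)] with z hz hz'
  exact pullbackForm_eq_coordRep θ he (hz.mdifferentiableAt (by simp)) hz'

theorem contDiffAt_chart_comp {e : OpenPartialHomeomorph M (Eucl n)}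
    (he : e ∈ atlas (Eucl n) M) {α : E → M} {y : E}
    (hα : ContMDiffAt 𝓘(ℝ, E) (𝓡 n) ∞ α y) (hy : α y ∈ e.source) :
    ContDiffAt ℝ ∞ (e ∘ α) y :=
  ((contMDiffAt_of_mem_maximalAtlas (IsManifold.subset_maximalAtlas he) hy).comp y hα).contDiffAt

theorem contDiffAt_pullbackForm [FiniteDimensional ℝ E] {k : ℕ} (θ : MForm k n M) {α : E → M}
    {y : E} (hα : ContMDiffAt 𝓘(ℝ, E) (𝓡 n) ∞ α y) :
    ContDiffAt ℝ ∞ (pullbackForm α θ.1) y := by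
  have he := chart_mem_atlas (Eucl n) (α y)
  have hy := mem_chart_source (Eucl n) (α y)
  have h1 := contDiffAt_chart_comp he hα hy
  refine ContDiffAt.congr_of_eventuallyEq ?_ (eventually_pullbackForm_eq_coordRep θ.1 he hα hy)
  have h2 : ContDiffAt ℝ ∞
      (coordRep θ.1 (chartAt (Eucl n) (α y)) ∘ (chartAt (Eucl n) (α y) ∘ α)) y :=
    (MForm.contDiffAt θ he ((chartAt (Eucl n) (α y)).map_source hy)).comp y h1
  exact contDiffAt_compContinuousLinearMap h2 (h1.fderiv_right (by simp))

theorem extDeriv_pullbackForm {k : ℕ} (θ : MForm k n M) {α : E → M}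
    {y : E} (hα : ContMDiffAt 𝓘(ℝ, E) (𝓡 n) ∞ α y) :
    extDeriv (pullbackForm α θ.1) y = pullbackForm α (extDerivM θ.1) y := by
  have he := chart_mem_atlas (Eucl n) (α y)
  have hy := mem_chart_source (Eucl n) (α y)
  have hy' := (chartAt (Eucl n) (α y)).map_source hy
  rw [(eventually_pullbackForm_eq_coordRep θ.1 he hα hy).extDeriv_eq,
    extDeriv_pullback (r := ∞) (f := chartAt (Eucl n) (α y) ∘ α)
      ((MForm.contDiffAt θ he hy').differentiableAt (by simp))
      (contDiffAt_chart_comp he hα hy) two_le_infty,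
    pullbackForm_eq_coordRep _ he (hα.mdifferentiableAt (by simp)) hy,
    coordRep_extDerivM θ he hy']
  rfl

end Pullback

/-! ### Localization of plots -/

section Localization

/-- A smooth map that is the identity near `y` and takes all its values in a given neighbourhood
of `y`. Precomposing with it turns a map that is smooth near `y` into a globally defined plot with
the same germ at `y`. -/
theorem exists_contDiff_eventuallyEq_id {E : Type*} [NormedAddCommGroup E] [NormedSpace ℝ E]
    [FiniteDimensional ℝ E] {y : E} {U : Set E} (hU : U ∈ 𝓝 y) :
    ∃ h : E → E, ContDiff ℝ ∞ h ∧ h =ᶠ[𝓝 y] id ∧ ∀ x, h x ∈ U := by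
  obtain ⟨r, hr, hrU⟩ := Metric.mem_nhds_iff.1 hU
  let f : ContDiffBump y := ⟨r / 2, r, by positivity, by linarith⟩
  refine ⟨fun x => y + f x • (x - y), ?_, ?_, fun x => hrU ?_⟩
  · exact contDiff_const.add (f.contDiff.smul (contDiff_id.sub contDiff_const))
  · filter_upwards [f.eventuallyEq_one] with x hx
    simp [hx]
  · rw [Metric.mem_ball, dist_eq_norm, add_sub_cancel_left, norm_smul, Real.norm_eq_abs,
      abs_of_nonneg f.nonneg]
    by_cases hx : dist x y < r
    · rw [dist_eq_norm] at hx
      exact (mul_le_of_le_one_left (norm_nonneg _) f.le_one).trans_lt hx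
    · rw [f.zero_of_le_dist (not_lt.1 hx), zero_mul]
      exact hr

/-- A form on a diffeological space is local: if `γ = γ' ∘ f` near `y`, then
`θ_γ = f^* θ_γ'` at `y`. -/
theorem DForm.apply_eq_of_eqOn {X : Type u} [DiffeologicalSpace X] {k l m : ℕ} (θ : DForm k X)
    (γ : Plot X l) (γ' : Plot X m) {U : Set (Eucl l)} (hU : IsOpen U) {y : Eucl l} (hy : y ∈ U)
    {f : Eucl l → Eucl m} (hf : ContDiffOn ℝ ∞ f U) (hγ : ∀ x ∈ U, γ.1 x = γ'.1 (f x)) :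
    θ.1 l γ y = (θ.1 m γ' (f y)).compContinuousLinearMap (fderiv ℝ f y) := by
  obtain ⟨h, hh, hid, hmem⟩ := exists_contDiff_eventuallyEq_id (hU.mem_nhds hy)
  have hhy : h y = y := hid.self_of_nhds
  have hfh : ContDiff ℝ ∞ (f ∘ h) :=
    contDiffOn_univ.1 (hf.comp hh.contDiffOn fun x _ => hmem x)
  have h1 : γ.reparam h hh = γ'.reparam (f ∘ h) hfh := Subtype.ext (funext fun x => hγ _ (hmem x))
  have h2 := θ.2.2 l l γ h hh y
  have h3 := θ.2.2 l m γ' (f ∘ h) hfh y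
  have h4 : f ∘ h =ᶠ[𝓝 y] f := hid.fun_comp f
  rw [h1, h3, hid.fderiv_eq, fderiv_id, h4.fderiv_eq] at h2
  simp only [Function.comp_apply, hhy] at h2
  rw [h2]
  rfl

theorem DForm.apply_congr {X : Type u} [DiffeologicalSpace X] {k m : ℕ} (θ : DForm k X)
    {γ γ' : Plot X m} {y : Eucl m} (hγ : γ.1 =ᶠ[𝓝 y] γ'.1) : θ.1 m γ y = θ.1 m γ' y := by
  obtain ⟨U, hU, hUo, hy⟩ := eventually_nhds_iff.1 hγ
  rw [DForm.apply_eq_of_eqOn θ γ γ' hUo hy contDiffOn_id hU, fderiv_id]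
  rfl

variable {n p q : ℕ} {M : Type u} [TopologicalSpace M] [ChartedSpace (Eucl n) M]

/-- A smooth map `ℝᵐ → M`, as a plot of the manifold diffeology. -/
def mkPlot {m : ℕ} (α : Eucl m → M) (hα : ContMDiff (𝓡 m) (𝓡 n) ∞ α) :
    @Plot M (manifoldDiffeology n M) m :=
  ⟨α, hα⟩

theorem contMDiff_plot {m : ℕ} (α : @Plot M (manifoldDiffeology n M) m) :
    ContMDiff (𝓡 m) (𝓡 n) ∞ α.1 :=
  α.2

/-- A map `ℝᵐ → M` that is smooth near `y` has the same germ at `y` as some plot of `M`. -/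
theorem exists_plot_eventuallyEq {m : ℕ} {α : Eucl m → M} {U : Set (Eucl m)} (hU : IsOpen U)
    (hα : ContMDiffOn (𝓡 m) (𝓡 n) ∞ α U) {y : Eucl m} (hy : y ∈ U) :
    ∃ β : @Plot M (manifoldDiffeology n M) m, β.1 =ᶠ[𝓝 y] α := by
  obtain ⟨h, hh, hid, hmem⟩ := exists_contDiff_eventuallyEq_id (hU.mem_nhds hy)
  exact ⟨mkPlot (α ∘ h) (contMDiffOn_univ.1 (hα.comp hh.contMDiff.contMDiffOn fun x _ => hmem x)),
    hid.fun_comp α⟩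

/-- The diffeology on `M/F` whose plots are the maps that locally lift to smooth maps into `M`. -/
abbrev Foliation.liftDiffeology (F : Foliation n p q M) : DiffeologicalSpace F.LeafSpace where
  plots m := {γ | ∀ y, ∃ α : @Plot M (manifoldDiffeology n M) m, γ =ᶠ[𝓝 y] F.proj ∘ α.1}
  constant_plots := by
    intro m x y
    obtain ⟨z, rfl⟩ : ∃ z, F.proj z = x := Quotient.exists_rep x
    exact ⟨mkPlot (fun _ => z) contMDiff_const, .rfl⟩
  plot_reparam := by
    intro l m γ f hγ hf y
    obtain ⟨α, hα⟩ := hγ (f y)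
    refine ⟨mkPlot (α.1 ∘ f) ((contMDiff_plot α).comp hf.contMDiff), ?_⟩
    exact hf.continuous.continuousAt.eventually hα
  locality := by
    intro m γ h y
    obtain ⟨U, hU, hy, H⟩ := h y
    obtain ⟨f, hf, hid, hmem⟩ := exists_contDiff_eventuallyEq_id (hU.mem_nhds hy)
    obtain ⟨α, hα⟩ := H hmem hf y
    refine ⟨α, ?_⟩
    filter_upwards [hα, hid] with x hx hx'
    rw [← hx, Function.comp_apply, hx']
    rfl

/-- Every plot of the leaf space locally lifts to a plot of `M`. -/
theorem Foliation.exists_lift (F : Foliation n p q M) {m : ℕ} (γ : Plot F.LeafSpace m)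
    (y : Eucl m) :
    ∃ α : @Plot M (manifoldDiffeology n M) m, γ.1 =ᶠ[𝓝 y] F.proj ∘ α.1 := by
  have h := γ.2 F.liftDiffeology
  refine h ?_ y
  rintro ⟨m, P⟩ ⟨α, hα, hP⟩ y
  exact ⟨⟨α, hα⟩, .of_eq hP⟩

end Localization

/-! ### The form on `M` induced by a form on the leaf space -/

section ProjPullback

variable {n p q : ℕ} {M : Type u} [TopologicalSpace M] [ChartedSpace (Eucl n) M]

/-- The value of `η` at `x` is recovered from its expression in a chart at `x`. -/
theorem apply_eq_pullbackForm_symm {E : Type*} [NormedAddCommGroup E] [NormedSpace ℝ E] {k : ℕ}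
    (η : AltField k n M) {e : OpenPartialHomeomorph M E} {x : M} (hx : x ∈ e.source)
    (h1 : MDifferentiableAt (𝓡 n) 𝓘(ℝ, E) e x)
    (h2 : MDifferentiableAt 𝓘(ℝ, E) (𝓡 n) e.symm (e x)) :
    η x = (pullbackForm e.symm η (e x)).compContinuousLinearMap
      (mfderiv (𝓡 n) 𝓘(ℝ, E) e x : TangentSpace (𝓡 n) x →L[ℝ] E) := by
  have h3 : e.symm ∘ e =ᶠ[𝓝 x] id := by
    filter_upwards [e.open_source.mem_nhds hx] with z hz
    exact e.left_inv hz
  have h4 := (mfderiv_comp x h2 h1).symm.trans (h3.mfderiv_eq.trans mfderiv_id)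
  exact pullbackForm_eq_of_eq (E := Eucl n) (L := ContinuousLinearMap.id ℝ (Eucl n)) η
    (e.left_inv hx).symm h4.symm

theorem Foliation.proj_eq_of_samePlaque (F : Foliation n p q M) {x y : M}
    (h : F.SamePlaque x y) : F.proj x = F.proj y :=
  Quotient.sound (Relation.EqvGen.rel _ _ h)

theorem Foliation.mdifferentiable_chart (F : Foliation n p q M) {e} (he : e ∈ F.charts) :
    e.MDifferentiable (𝓡 n) 𝓘(ℝ, Eucl p × Eucl q) :=
  ⟨(F.contMDiffOn e he).mdifferentiableOn (by simp),
    (F.contMDiffOn_symm e he).mdifferentiableOn (by simp)⟩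

theorem Foliation.contMDiffAt_symm (F : Foliation n p q M) {e} (he : e ∈ F.charts)
    {z : Eucl p × Eucl q} (hz : z ∈ e.target) :
    ContMDiffAt 𝓘(ℝ, Eucl p × Eucl q) (𝓡 n) ∞ e.symm z :=
  (F.contMDiffOn_symm e he).contMDiffAt (e.open_target.mem_nhds hz)

variable [IsManifold (𝓡 n) ∞ M]

theorem exists_chartPlot (x : M) : ∃ c : @Plot M (manifoldDiffeology n M) n,
    c.1 =ᶠ[𝓝 (chartAt (Eucl n) x x)] (chartAt (Eucl n) x).symm :=
  exists_plot_eventuallyEq (chartAt (Eucl n) x).open_target contMDiffOn_chart_symm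
    (mem_chart_target (Eucl n) x)

/-- A plot of `M` with the same germ at the image of `x` as the inverse of the preferred chart
at `x`. -/
def chartPlot (n : ℕ) {M : Type u} [TopologicalSpace M] [ChartedSpace (Eucl n) M]
    [IsManifold (𝓡 n) ∞ M] (x : M) : @Plot M (manifoldDiffeology n M) n :=
  (exists_chartPlot x).choose

theorem chartPlot_eventuallyEq (x : M) :
    (chartPlot n x).1 =ᶠ[𝓝 (chartAt (Eucl n) x x)] (chartAt (Eucl n) x).symm :=
  (exists_chartPlot x).choose_spec

/-- A field of forms on `M` is determined by its pull-backs along plots. -/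
theorem eq_of_pullbackForm_eq {k : ℕ} {η η' : AltField k n M}
    (h : ∀ α : @Plot M (manifoldDiffeology n M) n,
      pullbackForm α.1 η = pullbackForm α.1 η') : η = η' := by
  funext x
  have hc := chart_mem_atlas (Eucl n) x
  have h1 := mdifferentiableAt_chart hc (mem_chart_source _ x)
  have h2 := mdifferentiableAt_chart_symm hc (mem_chart_target _ x)
  rw [apply_eq_pullbackForm_symm η (mem_chart_source _ x) h1 h2,
    apply_eq_pullbackForm_symm η' (mem_chart_source _ x) h1 h2,
    ← pullbackForm_congr η (chartPlot_eventuallyEq x),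
    ← pullbackForm_congr η' (chartPlot_eventuallyEq x), h]

/-- The field of forms on `M` whose value at `x` is read off from the form `θ` on the leaf space
along the plot `p ∘ e⁻¹`, for `e` the preferred chart at `x`. -/
def Foliation.projPullbackField (F : Foliation n p q M) {k : ℕ} (θ : DForm k F.LeafSpace) :
    AltField k n M := fun x =>
  (θ.1 n (F.projPlot (chartPlot n x)) (chartAt (Eucl n) x x)).compContinuousLinearMap
    (mfderiv (𝓡 n) (𝓡 n) (chartAt (Eucl n) x) x : TangentSpace (𝓡 n) x →L[ℝ] Eucl n)

theorem Foliation.pullbackForm_projPullbackField (F : Foliation n p q M) {k m : ℕ}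
    (θ : DForm k F.LeafSpace) (α : @Plot M (manifoldDiffeology n M) m) :
    pullbackForm α.1 (F.projPullbackField θ) = θ.1 m (F.projPlot α) := by
  funext y
  have hc := chart_mem_atlas (Eucl n) (α.1 y)
  have hy := mem_chart_source (Eucl n) (α.1 y)
  have hα := contMDiff_plot α
  obtain ⟨V, hV, hVo, hyV⟩ := eventually_nhds_iff.1 (chartPlot_eventuallyEq (n := n) (α.1 y))
  have hU := ((chartAt (Eucl n) (α.1 y)).isOpen_inter_preimage hVo).preimage hα.continuous
  rw [DForm.apply_eq_of_eqOn θ (F.projPlot α) (F.projPlot (chartPlot n (α.1 y))) hU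
    (f := chartAt (Eucl n) (α.1 y) ∘ α.1) ⟨hy, hyV⟩ ?_ ?_]
  · have h1 : (fderiv ℝ (chartAt (Eucl n) (α.1 y) ∘ α.1) y : Eucl m →L[ℝ] Eucl n) =
        (mfderiv (𝓡 n) (𝓡 n) (chartAt (Eucl n) (α.1 y)) (α.1 y) :
          TangentSpace (𝓡 n) (α.1 y) →L[ℝ] Eucl n).comp
        (mfderiv (𝓡 m) (𝓡 n) α.1 y : Eucl m →L[ℝ] TangentSpace (𝓡 n) (α.1 y)) := by
      rw [← mfderiv_eq_fderiv]
      exact mfderiv_comp y (mdifferentiableAt_chart hc hy) (hα.mdifferentiableAt (by simp))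
    rw [h1]
    rfl
  · intro z hz
    exact (contDiffAt_chart_comp hc hα.contMDiffAt hz.1).contDiffWithinAt
  · intro z hz
    refine congrArg F.proj ?_
    exact (((chartAt (Eucl n) (α.1 y)).left_inv hz.1).symm.trans (hV _ hz.2).symm)

theorem Foliation.projPullbackField_mem (F : Foliation n p q M) {k : ℕ}
    (θ : DForm k F.LeafSpace) : F.projPullbackField θ ∈ MForm k n M := by
  intro e he y hy
  obtain ⟨c, hc⟩ := exists_plot_eventuallyEq (n := n) e.open_target
    (contMDiffOn_symm_of_mem_maximalAtlas (IsManifold.subset_maximalAtlas he)) hy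
  have h1 : coordRep (F.projPullbackField θ) e =ᶠ[𝓝 y] θ.1 n (F.projPlot c) := by
    filter_upwards [hc.eventuallyEq_nhds] with z hz
    rw [← F.pullbackForm_projPullbackField θ c]
    exact (pullbackForm_congr _ hz).symm
  exact ((θ.2.1 n (F.projPlot c)).contDiffAt.congr_of_eventuallyEq h1).contDiffWithinAt

theorem Foliation.extDerivM_projPullbackField (F : Foliation n p q M) {k : ℕ}
    (θ : DForm k F.LeafSpace) :
    extDerivM (F.projPullbackField θ) = F.projPullbackField (DForm.d k F.LeafSpace θ) := by
  refine eq_of_pullbackForm_eq fun α => ?_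
  rw [F.pullbackForm_projPullbackField]
  funext y
  have h := extDeriv_pullbackForm ⟨_, F.projPullbackField_mem θ⟩ (contMDiff_plot α).contMDiffAt
    (y := y)
  rw [← h, F.pullbackForm_projPullbackField]
  rfl

/-- In a foliated chart the composite `p ∘ e⁻¹` factors through the transverse coordinate, so that
the induced form vanishes on vectors tangent to the leaves. -/
theorem Foliation.interiorVanishes_projPullbackField (F : Foliation n p q M) {k : ℕ}
    (θ : DForm k F.LeafSpace) {X : ∀ x : M, TangentSpace (𝓡 n) x} (hX : F.IsTangent X) :
    InteriorVanishes X (F.projPullbackField θ) := by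
  intro x v i hv
  obtain ⟨e, he, hx⟩ := F.cover x
  obtain ⟨A, B, hA, -, hB, hAB⟩ := F.target_eq e he
  have hex : e x ∈ A ×ˢ B := hAB ▸ e.map_source hx
  obtain ⟨f, hf, hfid, hfA⟩ := exists_contDiff_eventuallyEq_id (hA.mem_nhds hex.1)
  obtain ⟨g, hg, hgid, hgB⟩ := exists_contDiff_eventuallyEq_id (hB.mem_nhds hex.2)
  let L : Eucl (p + q) ≃L[ℝ] Eucl p × Eucl q := ContinuousLinearEquiv.ofFinrankEq (by simp)
  let t : Eucl (p + q) → Eucl p × Eucl q := fun z => (f (L z).1, g (L z).2)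
  have ht : ContDiff ℝ ∞ t :=
    (hf.comp (contDiff_fst.comp L.contDiff)).prodMk (hg.comp (contDiff_snd.comp L.contDiff))
  have htm : ∀ z, t z ∈ e.target := fun z => hAB ▸ ⟨hfA _, hgB _⟩
  -- A plot with the germ of `e⁻¹` at `e x`, defined on a product so that plaques stay plaques.
  let β : @Plot M (manifoldDiffeology n M) (p + q) := mkPlot (e.symm ∘ t)
    (contMDiffOn_univ.1 ((F.contMDiffOn_symm e he).comp ht.contMDiff.contMDiffOn
      fun z _ => htm z))
  -- The projection onto the transversal through `x` does not change the leaf.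
  let r : Eucl (p + q) → Eucl (p + q) := fun z => L.symm ((e x).1, (L z).2)
  have hr : ContDiff ℝ ∞ r :=
    L.symm.contDiff.comp (contDiff_const.prodMk (contDiff_snd.comp L.contDiff))
  have hβr : F.projPlot β = (F.projPlot β).reparam r hr := by
    refine Subtype.ext (funext fun z => F.proj_eq_of_samePlaque
      ⟨e, he, e.map_target (htm _), e.map_target (htm _), ?_⟩)
    change (e (e.symm (t z))).2 = (e (e.symm (t (r z)))).2
    rw [e.right_inv (htm _), e.right_inv (htm _)]
    simp [t, r]
  have hrz : r (L.symm (e x)) = L.symm (e x) := by simp [r]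
  have hdr : fderiv ℝ r (L.symm (e x)) = (L.symm : _ →L[ℝ] _) ∘L
      (ContinuousLinearMap.inr ℝ (Eucl p) (Eucl q)) ∘L
        (ContinuousLinearMap.snd ℝ (Eucl p) (Eucl q)) ∘L
        (L : Eucl (p + q) →L[ℝ] _) := by
    have h1 : HasFDerivAt (fun z => ((e x).1, (L z).2)) ((0 : Eucl (p + q) →L[ℝ] Eucl p).prod
        ((ContinuousLinearMap.snd ℝ (Eucl p) (Eucl q)) ∘L (L : Eucl (p + q) →L[ℝ] _)))
        (L.symm (e x)) :=
      (hasFDerivAt_const _ _).prodMk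
        ((ContinuousLinearMap.snd ℝ (Eucl p) (Eucl q)).hasFDerivAt.comp _ L.hasFDerivAt)
    exact (L.symm.hasFDerivAt.comp _ h1).fderiv
  have hθ := θ.2.2 _ _ (F.projPlot β) r hr (L.symm (e x))
  rw [← hβr, hrz, hdr] at hθ
  have hβe : β.1 =ᶠ[𝓝 (L.symm (e x))] e.symm ∘ L := by
    have h1 := L.continuous.fst.continuousAt (x := L.symm (e x))
    have h2 := L.continuous.snd.continuousAt (x := L.symm (e x))
    simp only [ContinuousAt, ContinuousLinearEquiv.apply_symm_apply] at h1 h2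
    filter_upwards [h1.eventually hfid, h2.eventually hgid] with z hz hz'
    change e.symm (f (L z).1, g (L z).2) = _
    rw [hz, hz']
    rfl
  have hsymm : MDifferentiableAt 𝓘(ℝ, Eucl p × Eucl q) (𝓡 n) e.symm (L (L.symm (e x))) := by
    rw [L.apply_symm_apply]
    exact (F.mdifferentiable_chart he).mdifferentiableAt_symm (e.map_source hx)
  have hpull : pullbackForm β.1 (F.projPullbackField θ) (L.symm (e x)) =
      (pullbackForm e.symm (F.projPullbackField θ) (e x)).compContinuousLinearMap
        (L : Eucl (p + q) →L[ℝ] _) := by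
    rw [pullbackForm_congr _ hβe, pullbackForm_comp _ hsymm L.differentiableAt, L.fderiv,
      L.apply_symm_apply]
  rw [F.pullbackForm_projPullbackField] at hpull
  rw [apply_eq_pullbackForm_symm (F.projPullbackField θ) hx
    ((F.mdifferentiable_chart he).mdifferentiableAt hx)
    ((F.mdifferentiable_chart he).mdifferentiableAt_symm (e.map_source hx))]
  have key : ∀ w : Fin k → Eucl p × Eucl q, (w i).2 = 0 →
      pullbackForm e.symm (F.projPullbackField θ) (e x) w = 0 := by
    intro w hw
    have h1 : pullbackForm e.symm (F.projPullbackField θ) (e x) w =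
        θ.1 _ (F.projPlot β) (L.symm (e x)) (fun j => L.symm (w j)) := by
      rw [hpull]
      simp only [ContinuousAlternatingMap.compContinuousLinearMap_apply]
      congr 1
      funext j
      exact (L.apply_symm_apply _).symm
    rw [h1, hθ, ContinuousAlternatingMap.compContinuousLinearMap_apply]
    refine ContinuousAlternatingMap.map_coord_zero _ i ?_
    simp [hw]
  refine key _ ?_
  have := hX e he x hx
  rw [← hv] at this
  exact this

/-- The pull-back `p^*`, with values in the smooth forms on `M`. -/
def Foliation.projPullback (F : Foliation n p q M) (k : ℕ) :
    DForm k F.LeafSpace →ₗ[ℝ] MForm k n M where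
  toFun θ := ⟨F.projPullbackField θ, F.projPullbackField_mem θ⟩
  map_add' _ _ := rfl
  map_smul' _ _ := rfl

theorem Foliation.d_projPullback (F : Foliation n p q M) {k : ℕ} (θ : DForm k F.LeafSpace) :
    MForm.d k n M (F.projPullback k θ) = F.projPullback (k + 1) (DForm.d k F.LeafSpace θ) :=
  Subtype.ext (F.extDerivM_projPullbackField θ)

theorem Foliation.projPullback_mem_baseLike (F : Foliation n p q M) {k : ℕ}
    (θ : DForm k F.LeafSpace) : F.projPullback k θ ∈ F.BaseLike k := by
  intro X _ hX
  refine ⟨F.interiorVanishes_projPullbackField θ hX, ?_⟩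
  rw [F.d_projPullback]
  exact F.interiorVanishes_projPullbackField _ hX

/-- A form on the leaf space is determined by the form it induces on `M`, because the plots of
`M/F` locally lift to `M`. -/
theorem Foliation.projPullback_injective (F : Foliation n p q M) (k : ℕ) :
    Function.Injective (F.projPullback k) := by
  intro θ θ' h
  ext m γ y : 4
  obtain ⟨α, hα⟩ := F.exists_lift γ y
  have hα' : γ.1 =ᶠ[𝓝 y] (F.projPlot α).1 := hα
  rw [DForm.apply_congr θ hα', DForm.apply_congr θ' hα',
    ← F.pullbackForm_projPullbackField, ← F.pullbackForm_projPullbackField]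
  exact congrArg (fun η : MForm k n M => pullbackForm α.1 η.1 y) h

end ProjPullback

/-! ### Base-like forms in foliated charts -/

section BaseLike

variable {n p q : ℕ} {M : Type u} [TopologicalSpace M] [ChartedSpace (Eucl n) M]

/-- Along a plaque of `e`, the transverse coordinate of any other foliated chart is locally
constant. -/
theorem Foliation.eventually_plaque (F : Foliation n p q M) {e e'} (he : e ∈ F.charts)
    (he' : e' ∈ F.charts) {z : Eucl p × Eucl q} (hz : z ∈ e.target)
    (hz' : e.symm z ∈ e'.source) :
    ∀ᶠ a in 𝓝 z.1, (a, z.2) ∈ e.target ∧ e.symm (a, z.2) ∈ e'.source ∧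
      (e' (e.symm (a, z.2))).2 = (e' (e.symm z)).2 := by
  obtain ⟨g, hg⟩ := F.compatible e he e' he' _ ⟨e.map_target hz, hz'⟩
  have hp : Filter.Tendsto (fun a : Eucl p => (a, z.2)) (𝓝 z.1) (𝓝 z) :=
    (Continuous.prodMk_left z.2).tendsto z.1
  have hc := (e.continuousAt_symm hz).tendsto.comp hp
  filter_upwards [hp.eventually (e.open_target.mem_nhds hz),
    hc.eventually (e'.open_source.mem_nhds hz'), hc.eventually hg] with a h1 h2 h3
  refine ⟨h1, h2, ?_⟩
  rw [hg.self_of_nhds, e.right_inv hz]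
  exact h3.trans (by rw [Function.comp_apply, e.right_inv h1])

/-- Tangency to the leaves at a point does not depend on the foliated chart. -/
theorem Foliation.snd_mfderiv_eq_zero (F : Foliation n p q M) {e e'} (he : e ∈ F.charts)
    (he' : e' ∈ F.charts) {x : M} (hx : x ∈ e.source) (hx' : x ∈ e'.source)
    {v : TangentSpace (𝓡 n) x}
    (hv : ((mfderiv (𝓡 n) 𝓘(ℝ, Eucl p × Eucl q) e x :
      TangentSpace (𝓡 n) x →L[ℝ] Eucl p × Eucl q) v).2 = 0) :
    ((mfderiv (𝓡 n) 𝓘(ℝ, Eucl p × Eucl q) e' x :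
      TangentSpace (𝓡 n) x →L[ℝ] Eucl p × Eucl q) v).2 = 0 := by
  have hd := (F.mdifferentiable_chart he).mdifferentiableAt hx
  have hs := (F.mdifferentiable_chart he).mdifferentiableAt_symm (e.map_source hx)
  have hd' : MDifferentiableAt (𝓡 n) 𝓘(ℝ, Eucl p × Eucl q) e' (e.symm (e x)) := by
    rw [e.left_inv hx]
    exact (F.mdifferentiable_chart he').mdifferentiableAt hx'
  have hT : MDifferentiableAt 𝓘(ℝ, Eucl p × Eucl q) 𝓘(ℝ, Eucl p × Eucl q) (e' ∘ e.symm) (e x) :=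
    hd'.comp _ hs
  have h1 : e' =ᶠ[𝓝 x] (e' ∘ e.symm) ∘ e := by
    filter_upwards [e.open_source.mem_nhds hx] with z hz
    simp only [Function.comp_apply, e.left_inv hz]
  have h2 : (mfderiv (𝓡 n) 𝓘(ℝ, Eucl p × Eucl q) e' x :
      TangentSpace (𝓡 n) x →L[ℝ] Eucl p × Eucl q) =
      (fderiv ℝ (e' ∘ e.symm) (e x)).comp (mfderiv (𝓡 n) 𝓘(ℝ, Eucl p × Eucl q) e x :
        TangentSpace (𝓡 n) x →L[ℝ] Eucl p × Eucl q) := by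
    rw [← mfderiv_eq_fderiv]
    exact h1.mfderiv_eq.trans (mfderiv_comp x hT hd)
  -- Along the plaque through `x` the transverse coordinate of `e'` is constant.
  have h3 : (fun a : Eucl p => ((e' ∘ e.symm) (a, (e x).2)).2) =ᶠ[𝓝 (e x).1]
      fun _ => (e' (e.symm (e x))).2 :=
    (F.eventually_plaque he he' (e.map_source hx) (by rwa [e.left_inv hx])).mono
      fun a ha => ha.2.2
  have h4 : HasFDerivAt (fun a : Eucl p => ((e' ∘ e.symm) (a, (e x).2)).2)
      ((ContinuousLinearMap.snd ℝ (Eucl p) (Eucl q)).comp ((fderiv ℝ (e' ∘ e.symm) (e x)).comp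
        (ContinuousLinearMap.inl ℝ (Eucl p) (Eucl q)))) (e x).1 :=
    (ContinuousLinearMap.snd ℝ (Eucl p) (Eucl q)).hasFDerivAt.comp _
      (HasFDerivAt.comp (g := e' ∘ e.symm) (f := fun a => (a, (e x).2)) (e x).1
        hT.differentiableAt.hasFDerivAt (hasFDerivAt_prodMk_left (e x).1 (e x).2))
  have h5 := h4.unique ((hasFDerivAt_const (e' (e.symm (e x))).2 (e x).1).congr_of_eventuallyEq h3)
  rw [h2]
  have h6 : (mfderiv (𝓡 n) 𝓘(ℝ, Eucl p × Eucl q) e x :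
      TangentSpace (𝓡 n) x →L[ℝ] Eucl p × Eucl q) v =
      ContinuousLinearMap.inl ℝ (Eucl p) (Eucl q) ((mfderiv (𝓡 n) 𝓘(ℝ, Eucl p × Eucl q) e x :
      TangentSpace (𝓡 n) x →L[ℝ] Eucl p × Eucl q) v).1 := Prod.ext rfl hv
  exact (congrArg (fun u => (fderiv ℝ (e' ∘ e.symm) (e x) u).2) h6).trans
    (congrArg (fun T : Eucl p →L[ℝ] Eucl q => T _) h5)

variable [IsManifold (𝓡 n) ∞ M]

/-- Every vector tangent to a leaf is a value of a smooth vector field tangent to the foliation: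
cut off the vector field that is constant in a foliated chart. -/
theorem Foliation.exists_isTangent_eq (F : Foliation n p q M) [T2Space M] {e} (he : e ∈ F.charts)
    {x : M} (hx : x ∈ e.source) {v : TangentSpace (𝓡 n) x}
    (hv : ((mfderiv (𝓡 n) 𝓘(ℝ, Eucl p × Eucl q) e x :
      TangentSpace (𝓡 n) x →L[ℝ] Eucl p × Eucl q) v).2 = 0) :
    ∃ X : ∀ x : M, TangentSpace (𝓡 n) x,
      ContMDiff (𝓡 n) (𝓡 n).tangent ∞ (fun x => (⟨x, X x⟩ : TangentBundle (𝓡 n) M)) ∧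
        F.IsTangent X ∧ X x = v := by
  have : IsManifold (𝓡 n) 1 M := .of_le (n := ∞) (by simp)
  have hme := F.mdifferentiable_chart he
  have hinv : ∀ y ∈ e.source, (mfderiv (𝓡 n) 𝓘(ℝ, Eucl p × Eucl q) e y).IsInvertible :=
    fun y hy => ⟨hme.mfderiv hy, rfl⟩
  let w : Eucl p × Eucl q := (mfderiv (𝓡 n) 𝓘(ℝ, Eucl p × Eucl q) e x :
      TangentSpace (𝓡 n) x →L[ℝ] Eucl p × Eucl q) v
  let W : ∀ y : Eucl p × Eucl q, TangentSpace 𝓘(ℝ, Eucl p × Eucl q) y := fun _ => w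
  let Y : ∀ y : M, TangentSpace (𝓡 n) y :=
    VectorField.mpullback (𝓡 n) 𝓘(ℝ, Eucl p × Eucl q) e W
  obtain ⟨f, -, hf⟩ := (SmoothBumpFunction.nhds_basis_tsupport (I := 𝓡 n) x).mem_iff.1
    (e.open_source.mem_nhds hx)
  refine ⟨(f : M → ℝ) • Y, ?_, ?_, ?_⟩
  · refine ContMDiffOn.smul_section_of_tsupport f.contMDiff.contMDiffOn e.open_source hf ?_
    intro y hy
    refine ContMDiffAt.contMDiffWithinAt ?_
    refine ContMDiffAt.mpullback_vectorField_preimage (n := ∞) ?_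
      ((F.contMDiffOn e he).contMDiffAt (e.open_source.mem_nhds hy)) (hinv y hy) (by simp)
    exact contMDiffAt_vectorSpace_iff_contDiffAt.2 contDiffAt_const
  · intro e' he' y hy'
    by_cases hy : y ∈ e.source
    · refine F.snd_mfderiv_eq_zero he he' hy hy' ?_
      have h1 : (mfderiv (𝓡 n) 𝓘(ℝ, Eucl p × Eucl q) e y :
          TangentSpace (𝓡 n) y →L[ℝ] Eucl p × Eucl q) (Y y) = w :=
        (hinv y hy).self_apply_inverse w
      rw [Pi.smul_apply', map_smul, h1]
      exact (congrArg (f y • ·) hv).trans (smul_zero _)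
    · have h0 : f y = 0 := image_eq_zero_of_notMem_tsupport fun h => hy (hf h)
      rw [Pi.smul_apply', h0, zero_smul, map_zero]
      rfl
  · rw [Pi.smul_apply', f.eq_one, one_smul]
    exact (hinv x hx).inverse_apply_self v

variable [T2Space M]

/-- In a foliated chart a base-like form vanishes on vectors tangent to the plaques. -/
theorem Foliation.pullbackForm_symm_eq_zero (F : Foliation n p q M) {k : ℕ} {η : AltField k n M}
    (hη : ∀ X : (∀ x : M, TangentSpace (𝓡 n) x),
      ContMDiff (𝓡 n) (𝓡 n).tangent ∞ (fun x => (⟨x, X x⟩ : TangentBundle (𝓡 n) M)) →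
      F.IsTangent X → InteriorVanishes X η) {e} (he : e ∈ F.charts)
    {z : Eucl p × Eucl q} (hz : z ∈ e.target) {w : Fin k → Eucl p × Eucl q} {i : Fin k}
    (hw : (w i).2 = 0) : pullbackForm e.symm η z w = 0 := by
  have hme := F.mdifferentiable_chart he
  obtain ⟨X, hX, hXt, hXv⟩ := F.exists_isTangent_eq he (e.map_target hz)
    (v := (mfderiv 𝓘(ℝ, Eucl p × Eucl q) (𝓡 n) e.symm z :
      Eucl p × Eucl q →L[ℝ] TangentSpace (𝓡 n) (e.symm z)) (w i)) (by
      have := congrArg (fun T : Eucl p × Eucl q →L[ℝ] Eucl p × Eucl q => (T (w i)).2)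
        (hme.comp_symm_deriv hz)
      exact this.trans hw)
  exact hη X hX hXt _ _ i hXv.symm

/-- In a foliated chart the coefficients of a base-like form are constant along the plaques:
by Cartan's formula the Lie derivative along vectors tangent to the plaques vanishes. -/
theorem Foliation.BaseLike.fderiv_pullbackForm_symm (F : Foliation n p q M) {k : ℕ}
    {η : MForm k n M} (hη : η ∈ F.BaseLike k) {e} (he : e ∈ F.charts)
    {z : Eucl p × Eucl q} (hz : z ∈ e.target) (a : Eucl p) :
    fderiv ℝ (pullbackForm e.symm η.1) z (a, 0) = 0 := by
  have hd : DifferentiableAt ℝ (pullbackForm e.symm η.1) z :=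
    (contDiffAt_pullbackForm η (F.contMDiffAt_symm he hz)).differentiableAt (by simp)
  ext w
  have h1 := extDeriv_apply hd (Fin.cons (a, 0) w)
  have h0 : pullbackForm e.symm (extDerivM η.1) z (Fin.cons (a, 0) w) = 0 :=
    F.pullbackForm_symm_eq_zero (fun X hX hXt => (hη X hX hXt).2) he hz (i := 0) rfl
  rw [extDeriv_pullbackForm η (F.contMDiffAt_symm he hz), h0,
    Fin.sum_univ_succ, Finset.sum_eq_zero, add_zero] at h1
  -- In the formula for `dζ` on `(a, 0), w` only the derivative in the direction `(a, 0)` survives.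
  · rw [Fin.val_zero, pow_zero, one_smul, Fin.removeNth_zero, Fin.tail_cons, Fin.cons_zero] at h1
    have h2 := hd.hasFDerivAt.continuousAlternatingMap_apply_const w
    rw [h2.fderiv] at h1
    exact h1.symm
  · intro j _
    have h2 : (fun y => pullbackForm e.symm η.1 y
        (j.succ.removeNth (Fin.cons (a, 0) w : Fin (k + 1) → Eucl p × Eucl q))) =ᶠ[𝓝 z]
        fun _ => 0 := by
      filter_upwards [e.open_target.mem_nhds hz] with y hy
      have : NeZero k := ⟨fun h => by subst h; exact j.elim0⟩
      refine F.pullbackForm_symm_eq_zero (fun X hX hXt => (hη X hX hXt).1) he hy (i := 0) ?_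
      simp [Fin.removeNth]
    rw [h2.fderiv_eq]
    simp

/-- The coefficients of a base-like form in a foliated chart depend only on the transverse
coordinate, because plaques are connected. -/
theorem Foliation.BaseLike.pullbackForm_symm_eq (F : Foliation n p q M) {k : ℕ}
    {η : MForm k n M} (hη : η ∈ F.BaseLike k) {e} (he : e ∈ F.charts)
    {z z' : Eucl p × Eucl q} (hz : z ∈ e.target) (hz' : z' ∈ e.target) (h : z.2 = z'.2) :
    pullbackForm e.symm η.1 z = pullbackForm e.symm η.1 z' := by
  obtain ⟨A, B, hA, hAc, hB, hAB⟩ := F.target_eq e he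
  have hm : ∀ a ∈ A, (a, z.2) ∈ e.target := fun a ha => hAB ▸ ⟨ha, (hAB ▸ hz : z ∈ A ×ˢ B).2⟩
  have hd : ∀ a ∈ A, HasFDerivAt (fun a => pullbackForm e.symm η.1 (a, z.2))
      ((fderiv ℝ (pullbackForm e.symm η.1) (a, z.2)).comp
        (ContinuousLinearMap.inl ℝ (Eucl p) (Eucl q))) a := fun a ha =>
    HasFDerivAt.comp (g := pullbackForm e.symm η.1) (f := fun a => (a, z.2)) a
      ((contDiffAt_pullbackForm η (F.contMDiffAt_symm he (hm a ha))).differentiableAt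
        (by simp)).hasFDerivAt (hasFDerivAt_prodMk_left a z.2)
  have := hA.is_const_of_fderiv_eq_zero (𝕜 := ℝ) hAc.isPreconnected
    (fun a ha => (hd a ha).differentiableAt.differentiableWithinAt)
    (fun a ha => by
      rw [(hd a ha).fderiv]
      ext1 b
      exact BaseLike.fderiv_pullbackForm_symm F hη he (hm a ha) b)
    (hAB ▸ hz : z ∈ A ×ˢ B).1 (hAB ▸ hz' : z' ∈ A ×ˢ B).1
  rw [h] at this
  rw [← this, ← h]

/-- An alternating map on a product that vanishes as soon as one argument has zero second
component depends only on the second components of its arguments. -/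
theorem alternating_apply_eq_of_snd_eq {V W : Type*} [NormedAddCommGroup V] [NormedSpace ℝ V]
    [NormedAddCommGroup W] [NormedSpace ℝ W] {k : ℕ} (ζ : (V × W) [⋀^Fin k]→L[ℝ] ℝ)
    (hζ : ∀ (w : Fin k → V × W) (i : Fin k), (w i).2 = 0 → ζ w = 0)
    {w w' : Fin k → V × W} (h : ∀ i, (w i).2 = (w' i).2) : ζ w = ζ w' := by
  classical
  have key : ∀ s : Finset (Fin k), ζ (s.piecewise w' w) = ζ w := by
    intro s
    induction s using Finset.induction_on with
    | empty => simp
    | insert i s hi ih =>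
      rw [← ih, Finset.piecewise_insert, ← sub_eq_zero]
      have h1 : s.piecewise w' w = Function.update (s.piecewise w' w) i (w i) := by
        rw [eq_comm, Function.update_eq_self_iff, Finset.piecewise_eq_of_notMem _ _ _ hi]
      nth_rewrite 2 [h1]
      rw [← ContinuousAlternatingMap.map_update_sub]
      exact hζ _ i (by simp [h i])
  rw [← key Finset.univ, Finset.piecewise_univ]

/-- Two maps into a foliated chart with the same transverse coordinate pull a base-like form back
to the same form. -/
theorem Foliation.BaseLike.pullbackForm_eq (F : Foliation n p q M) {k : ℕ}
    {η : MForm k n M} (hη : η ∈ F.BaseLike k) {e} (he : e ∈ F.charts)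
    {E : Type*} [NormedAddCommGroup E] [NormedSpace ℝ E] {α β : E → M} {y : E}
    (hα : MDifferentiableAt 𝓘(ℝ, E) (𝓡 n) α y) (hβ : MDifferentiableAt 𝓘(ℝ, E) (𝓡 n) β y)
    (hαy : α y ∈ e.source) (hβy : β y ∈ e.source)
    (h : (fun z => (e (α z)).2) =ᶠ[𝓝 y] fun z => (e (β z)).2) :
    pullbackForm α η.1 y = pullbackForm β η.1 y := by
  have hme := F.mdifferentiable_chart he
  rw [pullbackForm_eq_pullbackForm_symm η.1 hαy (hme.mdifferentiableAt hαy)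
      (hme.mdifferentiableAt_symm (e.map_source hαy)) hα,
    pullbackForm_eq_pullbackForm_symm η.1 hβy (hme.mdifferentiableAt hβy)
      (hme.mdifferentiableAt_symm (e.map_source hβy)) hβ,
    BaseLike.pullbackForm_symm_eq F hη he (e.map_source hαy) (e.map_source hβy) h.self_of_nhds]
  have hα' : DifferentiableAt ℝ (e ∘ α) y :=
    ((hme.mdifferentiableAt hαy).comp y hα).differentiableAt
  have hβ' : DifferentiableAt ℝ (e ∘ β) y :=
    ((hme.mdifferentiableAt hβy).comp y hβ).differentiableAt
  have h1 := ((ContinuousLinearMap.snd ℝ (Eucl p) (Eucl q)).hasFDerivAt.comp y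
    hα'.hasFDerivAt).unique (((ContinuousLinearMap.snd ℝ (Eucl p) (Eucl q)).hasFDerivAt.comp y
    hβ'.hasFDerivAt).congr_of_eventuallyEq h)
  ext w
  refine alternating_apply_eq_of_snd_eq _ (fun w i hw => F.pullbackForm_symm_eq_zero
    (fun X hX hXt => (hη X hX hXt).1) he (e.map_source hβy) hw) fun i => ?_
  exact congrArg (fun T : E →L[ℝ] Eucl q => T (w i)) h1

end BaseLike

/-! ### Leaves through countably many plaque chains -/

section Slide

variable {n p q : ℕ} {M : Type u} [TopologicalSpace M] [ChartedSpace (Eucl n) M]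
  {ι : Type*} (c : ι → OpenPartialHomeomorph M (Eucl p × Eucl q))

/-- The partial map `M → M` that successively moves points inside plaques: each entry `(i, j)` of
the list moves a point of the chart `c i` within its plaque to the point whose tangential coordinate
is the `j`-th term of a dense sequence in `ℝᵖ`. The entries are applied from the last to the first.
The map is meaningful on `slideDomain c l`. -/
def slide : List (ι × ℕ) → M → M
  | [] => id
  | v :: l => fun x =>
    (c v.1).symm (TopologicalSpace.denseSeq (Eucl p) v.2, (c v.1 (slide l x)).2)

/-- The set of points of `M` at which all the moves of `slide c l` are defined. -/
def slideDomain : List (ι × ℕ) → Set M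
  | [] => Set.univ
  | v :: l => slideDomain l ∩ slide c l ⁻¹' ((c v.1).source ∩
      c v.1 ⁻¹' {z | (TopologicalSpace.denseSeq (Eucl p) v.2, z.2) ∈ (c v.1).target})

/-- The point `y` lies in a common plaque of some chart `c i` with the image of `x` under
some `slide`. -/
def Reaches (x y : M) : Prop :=
  ∃ (l : List (ι × ℕ)) (i : ι), x ∈ slideDomain c l ∧ slide c l x ∈ (c i).source ∧
    y ∈ (c i).source ∧ (c i (slide c l x)).2 = (c i y).2

variable {c} {F : Foliation n p q M} (hc : ∀ i, c i ∈ F.charts)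

include hc

theorem isOpen_slideDomain_and_contMDiffOn (l : List (ι × ℕ)) :
    IsOpen (slideDomain c l) ∧ ContMDiffOn (𝓡 n) (𝓡 n) ∞ (slide c l) (slideDomain c l) := by
  induction l with
  | nil => exact ⟨isOpen_univ, contMDiffOn_id⟩
  | cons v l ih =>
    have hpair : Continuous fun z : Eucl p × Eucl q =>
        (TopologicalSpace.denseSeq (Eucl p) v.2, z.2) := by fun_prop
    refine ⟨ih.2.continuousOn.isOpen_inter_preimage ih.1
      ((c v.1).isOpen_inter_preimage ((c v.1).open_target.preimage hpair)), ?_⟩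
    have h1 : ContMDiffOn (𝓡 n) 𝓘(ℝ, Eucl p × Eucl q) ∞ (fun x => c v.1 (slide c l x))
        (slideDomain c (v :: l)) :=
      (F.contMDiffOn _ (hc v.1)).comp (ih.2.mono Set.inter_subset_left) fun x hx => hx.2.1
    have h2 : ContMDiff 𝓘(ℝ, Eucl p × Eucl q) 𝓘(ℝ, Eucl p × Eucl q) ∞
        fun z : Eucl p × Eucl q => (TopologicalSpace.denseSeq (Eucl p) v.2, z.2) :=
      (contDiff_const.prodMk contDiff_snd).contMDiff
    exact (F.contMDiffOn_symm _ (hc v.1)).comp (h2.comp_contMDiffOn h1) fun x hx => hx.2.2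

theorem isOpen_slideDomain (l : List (ι × ℕ)) : IsOpen (slideDomain c l) :=
  (isOpen_slideDomain_and_contMDiffOn hc l).1

theorem contMDiffOn_slide (l : List (ι × ℕ)) :
    ContMDiffOn (𝓡 n) (𝓡 n) ∞ (slide c l) (slideDomain c l) :=
  (isOpen_slideDomain_and_contMDiffOn hc l).2

theorem contMDiffAt_slide_comp {E : Type*} [NormedAddCommGroup E] [NormedSpace ℝ E]
    (l : List (ι × ℕ)) {α : E → M} {y : E}
    (hα : ContMDiffAt 𝓘(ℝ, E) (𝓡 n) ∞ α y) (hy : α y ∈ slideDomain c l) :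
    ContMDiffAt 𝓘(ℝ, E) (𝓡 n) ∞ (slide c l ∘ α) y :=
  ((contMDiffOn_slide hc l).contMDiffAt ((isOpen_slideDomain hc l).mem_nhds hy)).comp y hα

/-- Base-like forms are invariant under `slide`. -/
theorem Foliation.BaseLike.pullbackForm_slide_comp [IsManifold (𝓡 n) ∞ M] [T2Space M] {k : ℕ}
    {η : MForm k n M} (hη : η ∈ F.BaseLike k)
    {E : Type*} [NormedAddCommGroup E] [NormedSpace ℝ E] [FiniteDimensional ℝ E]
    (l : List (ι × ℕ)) {α : E → M} {y : E}
    (hα : ContMDiffAt 𝓘(ℝ, E) (𝓡 n) ∞ α y) (hy : α y ∈ slideDomain c l) :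
    pullbackForm (slide c l ∘ α) η.1 y = pullbackForm α η.1 y := by
  induction l with
  | nil => rfl
  | cons v l ih =>
    rw [← ih hy.1]
    refine BaseLike.pullbackForm_eq F hη (hc v.1)
      ((contMDiffAt_slide_comp hc (v :: l) hα hy).mdifferentiableAt (by simp))
      ((contMDiffAt_slide_comp hc l hα hy.1).mdifferentiableAt (by simp))
      ((c v.1).map_target hy.2.2) hy.2.1 ?_
    filter_upwards [hα.continuousAt.preimage_mem_nhds
      ((isOpen_slideDomain hc (v :: l)).mem_nhds hy)] with z hz
    have h := congrArg Prod.snd ((c v.1).right_inv hz.2.2)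
    exact h

/-- A chain of plaques can be prolonged by a plaque of one of the charts `c j`. -/
theorem Reaches.trans_plaque {x y z : M} (h : Reaches c x y) {j : ι} (hy : y ∈ (c j).source)
    (hz : z ∈ (c j).source) (hyz : (c j y).2 = (c j z).2) : Reaches c x z := by
  obtain ⟨l, i, hx, hxi, hyi, hxy⟩ := h
  have h1 := F.eventually_plaque (hc i) (hc j) ((c i).map_source hyi)
    (by rwa [(c i).left_inv hyi])
  rw [(c i).left_inv hyi] at h1
  obtain ⟨U, hU, hUo, hyU⟩ := eventually_nhds_iff.1 h1
  -- Density provides a move within the last plaque that ends in the next chart.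
  obtain ⟨m, hm⟩ := (TopologicalSpace.denseRange_denseSeq (Eucl p)).exists_mem_open hUo ⟨_, hyU⟩
  obtain ⟨h2, h3, h4⟩ := hU _ hm
  rw [← hxy] at h2 h3 h4
  exact ⟨(i, m) :: l, j, ⟨hx, hxi, h2⟩, h3, hz, h4.trans hyz⟩

variable (hcov : ∀ x, ∃ i, x ∈ (c i).source)

include hcov

/-- Plaques of arbitrary foliated charts are chained by plaques of the charts `c i`, because they
are connected. -/
theorem Reaches.trans_samePlaque {x y z : M} (h : Reaches c x y) (hyz : F.SamePlaque y z) :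
    Reaches c x z := by
  obtain ⟨e, he, hy, hz, hyz⟩ := hyz
  obtain ⟨A, B, -, hA, -, hAB⟩ := F.target_eq e he
  have hyA : e y ∈ A ×ˢ B := hAB ▸ e.map_source hy
  have hzA : e z ∈ A ×ˢ B := hAB ▸ e.map_source hz
  have key := hA.isPreconnected.induction₂
    (fun a a' => Reaches c x (e.symm (a, (e y).2)) ↔ Reaches c x (e.symm (a', (e y).2)))
    (fun a ha => by
      have hat : (a, (e y).2) ∈ e.target := hAB ▸ ⟨ha, hyA.2⟩
      obtain ⟨i, hi⟩ := hcov (e.symm (a, (e y).2))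
      filter_upwards [nhdsWithin_le_nhds (F.eventually_plaque he (hc i) hat hi)] with a' ha'
      exact ⟨fun h => h.trans_plaque hc hi ha'.2.1 ha'.2.2.symm,
        fun h => h.trans_plaque hc ha'.2.1 hi ha'.2.2⟩)
    (fun _ _ _ _ _ _ h1 h2 => h1.trans h2) (fun _ _ _ _ h => h.symm) hyA.1 hzA.1
  simp only [Prod.mk.eta, e.left_inv hy] at key
  rw [hyz, Prod.mk.eta, e.left_inv hz] at key
  exact key.1 h

/-- Points of the same leaf are joined by one of countably many kinds of plaque chains. -/
theorem reaches_of_proj_eq {x y : M} (h : F.proj x = F.proj y) : Reaches c x y := by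
  have h1 : Relation.EqvGen F.SamePlaque x y := Quotient.exact h
  have h2 : ∀ a b, Relation.EqvGen F.SamePlaque a b → (Reaches c x a ↔ Reaches c x b) := by
    intro a b hab
    induction hab with
    | rel a b hab =>
      obtain ⟨e, he, ha, hb, hab'⟩ := hab
      exact ⟨fun h => h.trans_samePlaque hc hcov ⟨e, he, ha, hb, hab'⟩,
        fun h => h.trans_samePlaque hc hcov ⟨e, he, hb, ha, hab'.symm⟩⟩
    | refl => rfl
    | symm _ _ _ ih => exact ih.symm
    | trans _ _ _ _ _ ih ih' => exact ih.trans ih'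
  obtain ⟨i, hi⟩ := hcov x
  exact (h2 x y h1).1 ⟨[], i, trivial, hi, hi, rfl⟩

end Slide

/-! ### Plots with the same projection to the leaf space -/

section Descent

variable {n p q : ℕ} {M : Type u} [TopologicalSpace M] [ChartedSpace (Eucl n) M]

theorem Foliation.exists_countable_cover (F : Foliation n p q M) [SecondCountableTopology M] :
    ∃ s : Set M, s.Countable ∧ ∃ c : s → OpenPartialHomeomorph M (Eucl p × Eucl q),
      (∀ i, c i ∈ F.charts) ∧ ∀ x, ∃ i, x ∈ (c i).source := by
  choose e he hx using F.cover
  obtain ⟨s, hs, hU⟩ := TopologicalSpace.countable_cover_nhds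
    fun x => (e x).open_source.mem_nhds (hx x)
  refine ⟨s, hs, fun i => e i, fun i => he i, fun x => ?_⟩
  have : x ∈ ⋃ y ∈ s, (e y).source := hU ▸ Set.mem_univ x
  obtain ⟨y, hy, hxy⟩ := Set.mem_iUnion₂.1 this
  exact ⟨⟨y, hy⟩, hxy⟩

variable [T2Space M] [SecondCountableTopology M] [IsManifold (𝓡 n) ∞ M]

/-- Two plots of `M` with the same projection to the leaf space pull a base-like form back to the
same form. The domain is the union of countably many locally closed sets, on each of which the two
plots are linked by a fixed chain of plaques. The forms agree on the interiors of these sets, and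
the union of these interiors is dense by Baire's theorem. -/
theorem Foliation.BaseLike.pullbackForm_eq_of_proj_eq (F : Foliation n p q M) {k m : ℕ}
    {η : MForm k n M} (hη : η ∈ F.BaseLike k) (α β : @Plot M (manifoldDiffeology n M) m)
    (h : F.proj ∘ α.1 = F.proj ∘ β.1) : pullbackForm α.1 η.1 = pullbackForm β.1 η.1 := by
  obtain ⟨s, hs, c, hc, hcov⟩ := F.exists_countable_cover
  have := hs.to_subtype
  have hα := contMDiff_plot α
  have hβ := contMDiff_plot β
  let O : List (s × ℕ) × s → Set (Eucl m) := fun j =>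
    (slide c j.1 ∘ α.1) ⁻¹' (c j.2).source ∩ α.1 ⁻¹' slideDomain c j.1 ∩ β.1 ⁻¹' (c j.2).source
  let T : List (s × ℕ) × s → Set (Eucl m) := fun j =>
    {z ∈ O j | (c j.2 (slide c j.1 (α.1 z))).2 = (c j.2 (β.1 z)).2}
  have hO : ∀ j, IsOpen (O j) := fun j => by
    refine IsOpen.inter ?_ ((c j.2).open_source.preimage hβ.continuous)
    rw [Set.inter_comm]
    exact ((contMDiffOn_slide hc j.1).continuousOn.comp hα.continuous.continuousOn
      fun z hz => hz).isOpen_inter_preimage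
        ((isOpen_slideDomain hc j.1).preimage hα.continuous) (c j.2).open_source
  -- The set `T j` is relatively closed in the open set `O j`.
  have hTO : ∀ j, O j ∩ closure (T j) ⊆ T j := by
    rintro j z ⟨hz, hz'⟩
    refine ⟨hz, ?_⟩
    have := mem_closure_iff_nhdsWithin_neBot.1 hz'
    have h1 : ContinuousAt (fun z => (c j.2 (slide c j.1 (α.1 z))).2) z :=
      (((c j.2).continuousAt hz.1.1).comp
        (contMDiffAt_slide_comp hc j.1 hα.contMDiffAt hz.1.2).continuousAt).snd
    have h2 : ContinuousAt (fun z => (c j.2 (β.1 z)).2) z :=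
      (((c j.2).continuousAt hz.2).comp hβ.continuous.continuousAt).snd
    refine tendsto_nhds_unique_of_eventuallyEq (l := 𝓝[T j] z)
      (h1.tendsto.mono_left nhdsWithin_le_nhds) (h2.tendsto.mono_left nhdsWithin_le_nhds) ?_
    filter_upwards [self_mem_nhdsWithin] with w hw
    exact hw.2
  have hT : ⋃ j, closure (T j) = Set.univ := by
    refine Set.eq_univ_of_forall fun z => ?_
    obtain ⟨l, i, h1, h2, h3, h4⟩ := reaches_of_proj_eq hc hcov (congrFun h z)
    exact Set.mem_iUnion.2 ⟨(l, i), subset_closure ⟨⟨⟨h2, h1⟩, h3⟩, h4⟩⟩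
  have hZ : IsClosed {z | pullbackForm α.1 η.1 z = pullbackForm β.1 η.1 z} := by
    have hcont : ∀ γ : @Plot M (manifoldDiffeology n M) m, Continuous (pullbackForm γ.1 η.1) :=
      fun γ => continuous_iff_continuousAt.2 fun z =>
        (contDiffAt_pullbackForm η (contMDiff_plot γ).contMDiffAt).continuousAt
    exact isClosed_eq (hcont α) (hcont β)
  have hsub : ∀ j, interior (closure (T j)) ∩ T j ⊆
      {z | pullbackForm α.1 η.1 z = pullbackForm β.1 η.1 z} := by
    rintro j z ⟨hz, hzT⟩
    rw [Set.mem_ofPred_eq, ← BaseLike.pullbackForm_slide_comp hc hη j.1 hα.contMDiffAt hzT.1.1.2]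
    refine BaseLike.pullbackForm_eq F hη (hc j.2)
      ((contMDiffAt_slide_comp hc j.1 hα.contMDiffAt hzT.1.1.2).mdifferentiableAt (by simp))
      (hβ.mdifferentiableAt (by simp)) hzT.1.1.1 hzT.1.2 ?_
    filter_upwards [(hO j).mem_nhds hzT.1, isOpen_interior.mem_nhds hz] with w hw hw'
    exact (hTO j ⟨hw, interior_subset hw'⟩).2
  -- `T j` is dense in its closure, hence in the interior of its closure.
  have hdense := dense_iUnion_interior_of_closed (fun j => isClosed_closure (s := T j)) hT
  funext z
  refine (hZ.closure_subset_iff.2 (Set.iUnion_subset fun j => ?_)) (hdense z)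
  have h1 : interior (closure (T j)) ⊆ closure (interior (closure (T j)) ∩ T j) :=
    fun w hw => isOpen_interior.inter_closure ⟨hw, interior_subset hw⟩
  exact h1.trans (closure_minimal (hsub j) hZ)

theorem Foliation.BaseLike.pullbackForm_eq_of_proj_eventuallyEq (F : Foliation n p q M) {k m : ℕ}
    {η : MForm k n M} (hη : η ∈ F.BaseLike k) (α β : @Plot M (manifoldDiffeology n M) m)
    {y : Eucl m} (h : F.proj ∘ α.1 =ᶠ[𝓝 y] F.proj ∘ β.1) :
    pullbackForm α.1 η.1 y = pullbackForm β.1 η.1 y := by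
  obtain ⟨f, hf, hid, hmem⟩ := exists_contDiff_eventuallyEq_id h
  have h1 := BaseLike.pullbackForm_eq_of_proj_eq F hη
    (mkPlot (α.1 ∘ f) ((contMDiff_plot α).comp hf.contMDiff))
    (mkPlot (β.1 ∘ f) ((contMDiff_plot β).comp hf.contMDiff)) (funext fun z => hmem z)
  exact (pullbackForm_congr η.1 (hid.fun_comp α.1)).symm.trans
    ((congrFun h1 y).trans (pullbackForm_congr η.1 (hid.fun_comp β.1)))

/-- The family of forms on the plots of `M/F` obtained by pulling `η` back along local lifts. -/
def Foliation.descendFamily (F : Foliation n p q M) {k : ℕ} (η : AltField k n M) (m : ℕ)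
    (γ : Plot F.LeafSpace m) (y : Eucl m) : (Eucl m) [⋀^Fin k]→L[ℝ] ℝ :=
  pullbackForm (F.exists_lift γ y).choose.1 η y

theorem Foliation.BaseLike.descendFamily_eq (F : Foliation n p q M) {k m : ℕ}
    {η : MForm k n M} (hη : η ∈ F.BaseLike k) {γ : Plot F.LeafSpace m}
    {α : @Plot M (manifoldDiffeology n M) m} {y : Eucl m} (h : γ.1 =ᶠ[𝓝 y] F.proj ∘ α.1) :
    F.descendFamily η.1 m γ y = pullbackForm α.1 η.1 y :=
  BaseLike.pullbackForm_eq_of_proj_eventuallyEq F hη _ _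
    ((F.exists_lift γ y).choose_spec.symm.trans h)

theorem Foliation.BaseLike.descendFamily_mem (F : Foliation n p q M) {k : ℕ}
    {η : MForm k n M} (hη : η ∈ F.BaseLike k) :
    F.descendFamily η.1 ∈ DForm k F.LeafSpace := by
  refine ⟨fun m γ => contDiff_iff_contDiffAt.2 fun y => ?_, fun l m γ f hf y => ?_⟩
  · obtain ⟨α, hα⟩ := F.exists_lift γ y
    refine (contDiffAt_pullbackForm η (contMDiff_plot α).contMDiffAt).congr_of_eventuallyEq ?_
    filter_upwards [hα.eventuallyEq_nhds] with z hz
    exact BaseLike.descendFamily_eq F hη hz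
  · obtain ⟨α, hα⟩ := F.exists_lift γ (f y)
    have hα' : (γ.reparam f hf).1 =ᶠ[𝓝 y]
        F.proj ∘ (mkPlot (α.1 ∘ f) ((contMDiff_plot α).comp hf.contMDiff)).1 :=
      hf.continuous.continuousAt.eventually hα
    rw [BaseLike.descendFamily_eq F hη hα, BaseLike.descendFamily_eq F hη hα']
    exact pullbackForm_comp η.1 ((contMDiff_plot α).mdifferentiableAt (by simp))
      (hf.differentiable (by simp) y)

/-- Every base-like form is induced by a form on the leaf space. -/
theorem Foliation.exists_projPullback_eq (F : Foliation n p q M) {k : ℕ}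
    {η : MForm k n M} (hη : η ∈ F.BaseLike k) :
    ∃ θ : DForm k F.LeafSpace, F.projPullback k θ = η := by
  refine ⟨⟨_, BaseLike.descendFamily_mem F hη⟩, Subtype.ext (eq_of_pullbackForm_eq fun α => ?_)⟩
  refine (F.pullbackForm_projPullbackField _ α).trans (funext fun y => ?_)
  exact BaseLike.descendFamily_eq F hη .rfl

end Descent

/-! ### The isomorphism of complexes -/

section Complex

variable {n p q : ℕ} {M : Type u} [TopologicalSpace M] [ChartedSpace (Eucl n) M]
  [IsManifold (𝓡 n) ∞ M]

/-- The pull-back `p^* : Ω^k(M/F) → Ω_b^k(M, F)`. -/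
def Foliation.projPullbackBaseLike (F : Foliation n p q M) (k : ℕ) :
    DForm k F.LeafSpace →ₗ[ℝ] F.BaseLike k :=
  (F.projPullback k).codRestrict (F.BaseLike k) F.projPullback_mem_baseLike

theorem Foliation.projPullbackBaseLike_bijective [T2Space M] [SecondCountableTopology M]
    (F : Foliation n p q M) (k : ℕ) : Function.Bijective (F.projPullbackBaseLike k) := by
  refine ⟨fun θ θ' h => F.projPullback_injective k (congrArg Subtype.val h), fun η => ?_⟩
  obtain ⟨θ, hθ⟩ := F.exists_projPullback_eq η.2
  exact ⟨θ, Subtype.ext hθ⟩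

/-- The morphism of complexes `p^* : Ω^*(M/F) → Ω_b^*(M, F)`. -/
def Foliation.projPullbackHom (F : Foliation n p q M) :
    deRhamComplex F.LeafSpace ⟶ F.baseLikeComplex :=
  CochainComplex.ofHom (fun k => ModuleCat.ofHom (F.projPullbackBaseLike k)) fun k => by
    have h1 : (deRhamComplex F.LeafSpace).d k (k + 1) = ModuleCat.ofHom (DForm.d k F.LeafSpace) :=
      CochainComplex.of_d (fun k => ModuleCat.of ℝ (DForm k F.LeafSpace))
        (fun k => ModuleCat.ofHom (DForm.d k F.LeafSpace)) k
    have h2 : F.baseLikeComplex.d k (k + 1) = ModuleCat.ofHom (Foliation.BaseLike.d F k) :=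
      CochainComplex.of_d (fun k => ModuleCat.of ℝ (F.BaseLike k))
        (fun k => ModuleCat.ofHom (Foliation.BaseLike.d F k)) k
    rw [h1, h2]
    exact ModuleCat.hom_ext (LinearMap.ext fun θ => Subtype.ext (F.d_projPullback θ))

end Complex

end

end FoliationDeRham

theorem theorem3p1 {n p q : ℕ} {M : Type u} [TopologicalSpace M] [T2Space M]
    [SecondCountableTopology M] [ChartedSpace (FoliationDeRham.Eucl n) M] [IsManifold (𝓡 n) ∞ M]
    (F : FoliationDeRham.Foliation n p q M) :
    ∃ φ : FoliationDeRham.deRhamComplex F.LeafSpace ⟶ F.baseLikeComplex,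
      F.IsProjPullback φ ∧ IsIso φ ∧
      ∀ k : ℕ, IsIso (HomologicalComplex.homologyMap φ k :
        (FoliationDeRham.deRhamComplex F.LeafSpace).homology k ⟶
          F.baseLikeComplex.homology k) := by
  have hk (k : ℕ) : IsIso (F.projPullbackHom.f k) := by
    rw [ConcreteCategory.isIso_iff_bijective]
    exact F.projPullbackBaseLike_bijective k
  have hφ : IsIso F.projPullbackHom := HomologicalComplex.Hom.isIso_of_components _
  exact ⟨F.projPullbackHom, fun k θ m α => F.pullbackForm_projPullbackField θ α, hφ,
    fun k => inferInstance⟩
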